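/- Let $\mathbb F_q$ be a finite field, and for $n\ge 0$ let $\mathrm{UT}_n(q)$ be the group of upper triangular $n\times n$ matrices over $\mathbb F_q$ with ones on the diagonal ($\mathrm{UT}_0(q)$ has one element). Two elements $u,v\in\mathrm{UT}_n(q)$ lie in the same superclass if $v-1=x(u-1)y$ for some $x,y\in\mathrm{UT}_n(q)$. Let $\mathbf{SC}_n$ be the space of functions $\mathrm{UT}_n(q)\to\mathbb C$ that are constant on superclasses, and let $\mathbf{SC}=\bigoplus_{n\ge 0}\mathbf{SC}_n$. Identify $\mathbf{SC}_a\otimes\mathbf{SC}_b$ with the space of functions on $\mathrm{UT}_a(q)\times\mathrm{UT}_b(q)$ that are constant on products of superclasses, via $(\chi\otimes\psi)(u,v)=\chi(u)\psi(v)$. Define a product on $\mathbf{SC}$ by inflation: for $\chi\in\mathbf{SC}_a$ and $\psi\in\mathbf{SC}_b$, let $\chi\cdot\psi\in\mathbf{SC}_{a+b}$ be $$(\chi\cdot\psi)\begin{pmatrix}A&C\\0&B\end{pmatrix}=\chi(A)\,\psi(B),\qquad A\in\mathrm{UT}_a(q),\ B\in\mathrm{UT}_b(q).$$ For $A\subseteq[n]$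 let $\mathrm{UT}_{A|A^c}(q)$ be the group of all $u\in\mathrm{UT}_n(q)$ such that $u_{ij}=0$ whenever $i\ne j$ do not both lie in $A$ or both in $A^c$, and let $\mathrm{st}_A:\mathrm{UT}_{A|A^c}(q)\to\mathrm{UT}_{|A|}(q)\times\mathrm{UT}_{|A^c|}(q)$ be the isomorphism that takes $u$ to its submatrices with rows and columns in $A$ and in $A^c$. Define a coproduct on $\mathbf{SC}$ by straightened restriction: for $\chi\in\mathbf{SC}_n$, $$\Delta(\chi)=\sum_{A\subseteq[n]}\ \chi|_{\mathrm{UT}_{A|A^c}(q)}\circ\mathrm{st}_A^{-1}\ \in\ \bigoplus_{k=0}^n\mathbf{SC}_k\otimes\mathbf{SC}_{n-k}.$$ Then $\mathbf{SC}$, with this product and this coproduct, with the constant function $1\in\mathbf{SC}_0$ as unit, and with the counit that is zero on $\mathbf{SC}_n$ for $n\ge1$ and takes the value of a function at the only element of $\mathrm{UT}_0(q)$ on $\mathbf{SC}_0$, is a Hopf algebra over $\mathbb C$. It is cocommutative, and it is graded by the decomposition $\mathbf{SC}=\bigoplus_n\mathbf{SC}_n$: product, unit, coproduct, counit and antipode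 all respect this grading. -/

import Mathlib

open scoped TensorProduct

universe u

noncomputable section

/-- `UT n F` is the group of upper triangular `n × n` matrices over `F` with ones on the diagonal
(as a submonoid of all matrices; `UT.exists_inverse` says that it is a group). -/
def UT (n : ℕ) (F : Type*) [Field F] : Submonoid (Matrix (Fin n) (Fin n) F) where
  carrier := {u | (∀ i, u i i = 1) ∧ ∀ i j, j < i → u i j = 0}
  one_mem' := ⟨fun i => by simp, fun i j h => by simp [h.ne']⟩
  mul_mem' := by
    rintro u v ⟨hu1, hu0⟩ ⟨hv1, hv0⟩
    refine ⟨fun i => ?_, fun i j hij => ?_⟩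
    · rw [Matrix.mul_apply, Finset.sum_eq_single i]
      · simp [hu1, hv1]
      · intro k _ hk
        rcases lt_or_gt_of_ne hk with h | h
        · simp [hu0 _ _ h]
        · simp [hv0 _ _ h]
      · simp
    · rw [Matrix.mul_apply]
      refine Finset.sum_eq_zero fun k _ => ?_
      rcases lt_or_ge k i with h | h
      · simp [hu0 _ _ h]
      · simp [hv0 _ _ (hij.trans_le h)]

theorem UT.exists_inverse {n : ℕ} {F : Type*} [Field F] (u : UT n F) :
    ∃ v : UT n F, u * v = 1 ∧ v * u = 1 := by
  obtain ⟨u, hu1, hu0⟩ := u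
  have hbt : u.BlockTriangular id := fun i j h => hu0 i j h
  have hdet : IsUnit u.det := by
    rw [Matrix.det_of_isUpperTriangular hbt]; simp [hu1]
  have : Invertible u := Matrix.invertibleOfIsUnitDet u hdet
  have hbt' : u⁻¹.BlockTriangular id := Matrix.blockTriangular_inv_of_blockTriangular hbt
  have hmul : u * u⁻¹ = 1 := Matrix.mul_nonsing_inv u hdet
  refine ⟨⟨u⁻¹, fun i => ?_, fun i j h => hbt' h⟩, Subtype.ext hmul,
    Subtype.ext (Matrix.nonsing_inv_mul u hdet)⟩
  have h := congrFun (congrFun hmul i) i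
  rw [Matrix.mul_apply, Finset.sum_eq_single i] at h
  · simpa [hu1] using h
  · intro k _ hk
    rcases lt_or_gt_of_ne hk with h | h
    · simp [hu0 _ _ h]
    · have : u⁻¹ k i = 0 := hbt' h
      simp [this]
  · simp

/-- `u` and `v` lie in the same superclass: `u - 1` and `v - 1` lie in the same orbit of the
two-sided action of `UT n F` on strictly upper triangular matrices. -/
def SameSuperclass {n : ℕ} {F : Type*} [Field F] (u v : UT n F) : Prop :=
  ∃ x y : UT n F, (v : Matrix (Fin n) (Fin n) F) - 1 =
    (x : Matrix (Fin n) (Fin n) F) * ((u : Matrix (Fin n) (Fin n) F) - 1) *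
      (y : Matrix (Fin n) (Fin n) F)

theorem SameSuperclass.refl {n : ℕ} {F : Type*} [Field F] (u : UT n F) : SameSuperclass u u :=
  ⟨1, 1, by simp⟩

/-- The space of complex functions on `UT n F` that are constant on superclasses. -/
def SuperclassFun (n : ℕ) (F : Type*) [Field F] : Submodule ℂ (UT n F → ℂ) where
  carrier := {χ | ∀ u v, SameSuperclass u v → χ u = χ v}
  zero_mem' := fun _ _ _ => rfl
  add_mem' := fun ha hb u v h => by simp [ha u v h, hb u v h]
  smul_mem' := fun c _ ha u v h => by simp [ha u v h]

/-- The space of complex functions on the group `UT a F × UT b F` that are constant on the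
superclasses of this product, which are the products of superclasses. -/
def SuperclassFunProd (a b : ℕ) (F : Type*) [Field F] : Submodule ℂ (UT a F × UT b F → ℂ) where
  carrier := {χ | ∀ p p', SameSuperclass p.1 p'.1 → SameSuperclass p.2 p'.2 → χ p = χ p'}
  zero_mem' := fun _ _ _ _ => rfl
  add_mem' := fun ha hb u v h h' => by simp [ha u v h h', hb u v h h']
  smul_mem' := fun c _ ha u v h h' => by simp [ha u v h h']

/-! ### Tensor products of superclass functions -/

/-- `(χ, ψ) ↦ χ × ψ`, where `(χ × ψ) (u, v) = χ u * ψ v`. -/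
def SuperclassFun.cross (a b : ℕ) (F : Type*) [Field F] :
    SuperclassFun a F →ₗ[ℂ] SuperclassFun b F →ₗ[ℂ] SuperclassFunProd a b F :=
  LinearMap.mk₂ ℂ
    (fun χ ψ => ⟨fun p => χ.1 p.1 * ψ.1 p.2, fun p p' h h' => by
      simp only [χ.2 _ _ h, ψ.2 _ _ h']⟩)
    (fun χ χ' ψ => Subtype.ext <| funext fun p => by simp [add_mul])
    (fun c χ ψ => Subtype.ext <| funext fun p => by simp [mul_assoc])
    (fun χ ψ ψ' => Subtype.ext <| funext fun p => by simp [mul_add])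
    (fun c χ ψ => Subtype.ext <| funext fun p => by simp [mul_left_comm])

theorem SuperclassFun.lift_cross_bijective (a b : ℕ) (F : Type*) [Field F] [Finite F] :
    Function.Bijective (TensorProduct.lift (SuperclassFun.cross a b F)) := by
  have : Module.Finite ℂ (UT b F → ℂ) := inferInstance
  let B := Module.finBasis ℂ (SuperclassFun b F)
  constructor
  · refine (injective_iff_map_eq_zero _).2 fun t ht => ?_
    obtain ⟨f, rfl⟩ := TensorProduct.eq_repr_basis_right B t
    suffices hf : f = 0 by simp [hf]
    ext i u
    have h0 : ∑ i, (f i).1 u • B i = 0 := by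
      refine Subtype.ext <| funext fun v => ?_
      have := congrFun (congrArg Subtype.val ht) (u, v)
      simpa [Finsupp.sum_fintype, SuperclassFun.cross, map_sum] using this
    have := Fintype.linearIndependent_iff.1 B.linearIndependent (fun i => (f i).1 u) h0 i
    simpa using this
  · intro G
    let g (u : UT a F) : SuperclassFun b F :=
      ⟨fun v => G.1 (u, v), fun v v' h => G.2 (u, v) (u, v') (SameSuperclass.refl u) h⟩
    have hg : ∀ u u', SameSuperclass u u' → g u = g u' := fun u u' h =>
      Subtype.ext <| funext fun v => G.2 (u, v) (u', v) h (SameSuperclass.refl v)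
    refine ⟨∑ i, (⟨fun u => B.repr (g u) i, fun u u' h => by simp only [hg u u' h]⟩ :
      SuperclassFun a F) ⊗ₜ B i, ?_⟩
    refine Subtype.ext <| funext fun p => ?_
    have := congrFun (congrArg Subtype.val (B.sum_repr (g p.1))) p.2
    simp only [map_sum, TensorProduct.lift.tmul, SuperclassFun.cross, LinearMap.mk₂_apply,
      AddSubmonoidClass.coe_finsetSum, Finset.sum_apply]
    simpa only [AddSubmonoidClass.coe_finsetSum, Finset.sum_apply, Submodule.coe_smul,
      Pi.smul_apply, smul_eq_mul] using this

/-- The identification of `SC_a ⊗ SC_b` with the superclass functions on `UT a F × UT b F`,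
sending `χ ⊗ ψ` to `χ × ψ`. -/
def SuperclassFun.tensorEquiv (a b : ℕ) (F : Type*) [Field F] [Finite F] :
    SuperclassFun a F ⊗[ℂ] SuperclassFun b F ≃ₗ[ℂ] SuperclassFunProd a b F :=
  LinearEquiv.ofBijective _ (SuperclassFun.lift_cross_bijective a b F)

/-! ### Inflation -/

theorem UT.submatrix_castAdd_mul {a b : ℕ} {F : Type*} [Field F]
    (M N : Matrix (Fin (a + b)) (Fin (a + b)) F) (hN : ∀ i j : Fin (a + b), j < i → N i j = 0) :
    (M * N).submatrix (Fin.castAdd b) (Fin.castAdd b) =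
      M.submatrix (Fin.castAdd b) (Fin.castAdd b) *
        N.submatrix (Fin.castAdd b) (Fin.castAdd b) := by
  ext i j
  have : ∀ k : Fin b, N (Fin.natAdd a k) (Fin.castAdd b j) = 0 := fun k =>
    hN _ _ (by simp [Fin.lt_def]; omega)
  simp [Matrix.mul_apply, Fin.sum_univ_add, this]

theorem UT.submatrix_natAdd_mul {a b : ℕ} {F : Type*} [Field F]
    (M N : Matrix (Fin (a + b)) (Fin (a + b)) F) (hM : ∀ i j : Fin (a + b), j < i → M i j = 0) :
    (M * N).submatrix (Fin.natAdd a) (Fin.natAdd a) =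
      M.submatrix (Fin.natAdd a) (Fin.natAdd a) *
        N.submatrix (Fin.natAdd a) (Fin.natAdd a) := by
  ext i j
  have : ∀ k : Fin a, M (Fin.natAdd a i) (Fin.castAdd b k) = 0 := fun k =>
    hM _ _ (by simp [Fin.lt_def]; omega)
  simp [Matrix.mul_apply, Fin.sum_univ_add, this]

/-- The upper left `a × a` block. -/
def UT.upperBlock {a b : ℕ} {F : Type*} [Field F] (u : UT (a + b) F) : UT a F :=
  ⟨u.1.submatrix (Fin.castAdd b) (Fin.castAdd b), fun _ => u.2.1 _, fun _ _ h =>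
    u.2.2 _ _ ((Fin.strictMono_castAdd b) h)⟩

/-- The lower right `b × b` block. -/
def UT.lowerBlock {a b : ℕ} {F : Type*} [Field F] (u : UT (a + b) F) : UT b F :=
  ⟨u.1.submatrix (Fin.natAdd a) (Fin.natAdd a), fun _ => u.2.1 _, fun _ _ h =>
    u.2.2 _ _ ((Fin.strictMono_natAdd a) h)⟩

theorem UT.mul_sub_one_lower {n : ℕ} {F : Type*} [Field F] (x u : UT n F) (i j : Fin n)
    (h : j < i) : (x.1 * (u.1 - 1)) i j = 0 := by
  have h1 := (x * u).2.2 i j h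
  have h2 := x.2.2 i j h
  rw [mul_sub, mul_one, Matrix.sub_apply, h2, sub_zero]
  exact h1

theorem SameSuperclass.upperBlock {a b : ℕ} {F : Type*} [Field F] {u v : UT (a + b) F}
    (h : SameSuperclass u v) : SameSuperclass (UT.upperBlock u) (UT.upperBlock v) := by
  obtain ⟨x, y, h⟩ := h
  refine ⟨(UT.upperBlock x), (UT.upperBlock y), ?_⟩
  have h' := congrArg (fun M => M.submatrix (Fin.castAdd b) (Fin.castAdd b)) h
  have hu : ∀ i j, j < i → (u.1 - 1) i j = 0 := fun i j hij => by
    simpa using UT.mul_sub_one_lower 1 u i j hij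
  rw [UT.submatrix_castAdd_mul _ _ y.2.2, UT.submatrix_castAdd_mul _ _ hu] at h'
  simpa [UT.upperBlock, Matrix.submatrix_sub,
    Matrix.submatrix_one _ (Fin.castAdd_injective a b)] using h'

theorem SameSuperclass.lowerBlock {a b : ℕ} {F : Type*} [Field F] {u v : UT (a + b) F}
    (h : SameSuperclass u v) : SameSuperclass (UT.lowerBlock u) (UT.lowerBlock v) := by
  obtain ⟨x, y, h⟩ := h
  refine ⟨(UT.lowerBlock x), (UT.lowerBlock y), ?_⟩
  have h' := congrArg (fun M => M.submatrix (Fin.natAdd a) (Fin.natAdd a)) h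
  rw [UT.submatrix_natAdd_mul _ _ (UT.mul_sub_one_lower x u),
    UT.submatrix_natAdd_mul _ _ x.2.2] at h'
  simpa [UT.lowerBlock, Matrix.submatrix_sub,
    Matrix.submatrix_one _ (Fin.natAdd_injective b a)] using h'

/-- Inflation from `UT a F × UT b F` to `UT (a + b) F` along the projection `τ` of a matrix onto
its two diagonal blocks. -/
def SuperclassFun.inflation (a b : ℕ) (F : Type*) [Field F] :
    SuperclassFunProd a b F →ₗ[ℂ] SuperclassFun (a + b) F where
  toFun χ := ⟨fun u => χ.1 (UT.upperBlock u, UT.lowerBlock u),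
    fun _ _ h => χ.2 _ _ (SameSuperclass.upperBlock h) (SameSuperclass.lowerBlock h)⟩
  map_add' _ _ := rfl
  map_smul' _ _ := rfl

/-! ### Restriction to `UT_{A|Aᶜ}` followed by straightening -/

/-- The inverse of the straightening isomorphism
`UT_{A|Aᶜ} → UT_{|A|} × UT_{|Aᶜ|}`: the matrix of `UT_n` whose rows and columns in `A`, in their
order, form `u`, whose rows and columns in `Aᶜ`, in their order, form `v`, and whose other
entries are zero. -/
def UT.straightenInv {n : ℕ} {F : Type*} [Field F] (A : Finset (Fin n))
    (p : UT A.card F × UT Aᶜ.card F) : UT n F :=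
  ⟨Matrix.reindex (finSumEquivOfFinset (s := A) rfl rfl) (finSumEquivOfFinset (s := A) rfl rfl)
      (Matrix.fromBlocks p.1.1 0 0 p.2.1), by
    refine ⟨fun i => ?_, fun i j h => ?_⟩
    · obtain ⟨i | i, rfl⟩ := (finSumEquivOfFinset (s := A) rfl rfl).surjective i
      · simpa [-finSumEquivOfFinset_inl] using p.1.2.1 i
      · simpa [-finSumEquivOfFinset_inr] using p.2.2.1 i
    · obtain ⟨i | i, rfl⟩ := (finSumEquivOfFinset (s := A) rfl rfl).surjective i <;>
      obtain ⟨j | j, rfl⟩ := (finSumEquivOfFinset (s := A) rfl rfl).surjective j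
      · simpa [-finSumEquivOfFinset_inl] using p.1.2.2 i j (by simpa using h)
      · simp [-finSumEquivOfFinset_inl, -finSumEquivOfFinset_inr]
      · simp [-finSumEquivOfFinset_inl, -finSumEquivOfFinset_inr]
      · simpa [-finSumEquivOfFinset_inr] using p.2.2.2 i j (by simpa using h)⟩

theorem SameSuperclass.straightenInv {n : ℕ} {F : Type*} [Field F] (A : Finset (Fin n))
    {p p' : UT A.card F × UT Aᶜ.card F} (h : SameSuperclass p.1 p'.1)
    (h' : SameSuperclass p.2 p'.2) :
    SameSuperclass (UT.straightenInv A p) (UT.straightenInv A p') := by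
  obtain ⟨x, y, h⟩ := h
  obtain ⟨x', y', h'⟩ := h'
  refine ⟨UT.straightenInv A (x, x'), UT.straightenInv A (y, y'), ?_⟩
  have h1 : (1 : Matrix (Fin n) (Fin n) F) =
      (Matrix.fromBlocks 1 0 0 1).submatrix (finSumEquivOfFinset (s := A) rfl rfl).symm
        (finSumEquivOfFinset (s := A) rfl rfl).symm := by
    simp
  simp only [UT.straightenInv, Matrix.reindex_apply]
  have h2 : ∀ M N : Matrix (Fin A.card ⊕ Fin Aᶜ.card) (Fin A.card ⊕ Fin Aᶜ.card) F,
      M.submatrix (finSumEquivOfFinset (s := A) rfl rfl).symm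
          (finSumEquivOfFinset (s := A) rfl rfl).symm -
        N.submatrix (finSumEquivOfFinset (s := A) rfl rfl).symm
          (finSumEquivOfFinset (s := A) rfl rfl).symm =
      (M - N).submatrix (finSumEquivOfFinset (s := A) rfl rfl).symm
          (finSumEquivOfFinset (s := A) rfl rfl).symm := fun _ _ => rfl
  have h3 : ∀ (M M' : Matrix (Fin A.card) (Fin A.card) F)
      (N N' : Matrix (Fin Aᶜ.card) (Fin Aᶜ.card) F),
      Matrix.fromBlocks M 0 0 N - Matrix.fromBlocks M' 0 0 N' =
        Matrix.fromBlocks (M - M') 0 0 (N - N') := fun M M' N N' => by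
    simp [sub_eq_add_neg, Matrix.fromBlocks_neg, Matrix.fromBlocks_add]
  rw [h1, h2, h2, Matrix.submatrix_mul_equiv, Matrix.submatrix_mul_equiv, h3, h3, h, h']
  simp [Matrix.fromBlocks_multiply]

/-- The straightened restriction `χ ↦ Res(χ) ∘ st⁻¹` for the set composition `(A | Aᶜ)`. -/
def SuperclassFun.restriction {n : ℕ} (F : Type*) [Field F] (A : Finset (Fin n)) :
    SuperclassFun n F →ₗ[ℂ] SuperclassFunProd A.card Aᶜ.card F where
  toFun χ := ⟨fun p => χ.1 (UT.straightenInv A p),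
    fun _ _ h h' => χ.2 _ _ (SameSuperclass.straightenInv A h h')⟩
  map_add' _ _ := rfl
  map_smul' _ _ := rfl

/-! ### The space `SC` and its operations -/

/-- `SC = ⨁ₙ SCₙ`, the space of superclass functions on all the groups `UT n F`. -/
abbrev SC (F : Type u) [Field F] : Type u := DirectSum ℕ fun n => SuperclassFun n F

/-- The inclusion of `SCₙ` into `SC`. -/
def SC.of (F : Type*) [Field F] (n : ℕ) : SuperclassFun n F →ₗ[ℂ] SC F :=
  DirectSum.lof ℂ ℕ (fun n => SuperclassFun n F) n

/-- The homogeneous component of degree `n`, as a subspace of `SC`. -/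
def SC.degree (F : Type*) [Field F] (n : ℕ) : Submodule ℂ (SC F) := LinearMap.range (SC.of F n)

/-- The product: `χ · ψ = Inf (χ × ψ)` for `χ` in `SC_a` and `ψ` in `SC_b`. -/
def SC.mul (F : Type*) [Field F] : SC F →ₗ[ℂ] SC F →ₗ[ℂ] SC F :=
  DirectSum.toModule ℂ ℕ _ fun a => LinearMap.flip <|
    DirectSum.toModule ℂ ℕ _ fun b => LinearMap.flip <|
      (SuperclassFun.cross a b F).compr₂ (SC.of F (a + b) ∘ₗ SuperclassFun.inflation a b F)

/-- The unit: the constant function `1` on the one-element group `UT 0 F`. -/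
def SC.one (F : Type*) [Field F] : SC F := SC.of F 0 ⟨fun _ => 1, fun _ _ _ => rfl⟩

/-- The coproduct: `Δ χ = ∑_{A ⊆ [n]} Res_{A|Aᶜ} χ` for `χ` in `SCₙ`. -/
def SC.comul (F : Type*) [Field F] [Finite F] : SC F →ₗ[ℂ] SC F ⊗[ℂ] SC F :=
  DirectSum.toModule ℂ ℕ _ fun n => ∑ A : Finset (Fin n),
    TensorProduct.map (SC.of F A.card) (SC.of F Aᶜ.card) ∘ₗ
      (SuperclassFun.tensorEquiv A.card Aᶜ.card F).symm.toLinearMap ∘ₗ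
        SuperclassFun.restriction F A

/-- The counit: zero in positive degrees, the value at the only element of `UT 0 F` in degree
zero. -/
def SC.counit (F : Type*) [Field F] : SC F →ₗ[ℂ] ℂ :=
  LinearMap.proj (1 : UT 0 F) ∘ₗ (SuperclassFun 0 F).subtype ∘ₗ
    DirectSum.component ℂ ℕ (fun n => SuperclassFun n F) 0

/-- A grading of a Hopf algebra by `ℕ`: a direct sum decomposition that is respected by the
product, unit, coproduct, counit and antipode. -/
structure IsHopfGrading {k H : Type*} [Field k] [Ring H] [HopfAlgebra k H]
    (𝒜 : ℕ → Submodule k H) : Prop where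
  isInternal : DirectSum.IsInternal 𝒜
  one_mem : (1 : H) ∈ 𝒜 0
  mul_mem : ∀ i j : ℕ, ∀ x ∈ 𝒜 i, ∀ y ∈ 𝒜 j, x * y ∈ 𝒜 (i + j)
  comul_mem : ∀ n : ℕ, ∀ x ∈ 𝒜 n, Coalgebra.comul (R := k) x ∈
    ⨆ p ∈ Finset.HasAntidiagonal.antidiagonal n,
      LinearMap.range (TensorProduct.map (𝒜 p.1).subtype (𝒜 p.2).subtype)
  counit_eq_zero : ∀ n : ℕ, 1 ≤ n → ∀ x ∈ 𝒜 n, Coalgebra.counit (R := k) x = 0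
  antipode_mem : ∀ n : ℕ, ∀ x ∈ 𝒜 n, HopfAlgebra.antipode k x ∈ 𝒜 n

end

noncomputable section

/-! ### Infinite unitriangular matrices -/

/-! An element of `SC F` is known once all its values are known, so each Hopf axiom can be checked
on values. To keep sizes such as `a + b + c` out of the types, one evaluates at truncations of
infinite unitriangular matrices: `eval n u` is the value of the degree `n` component at the upper
left `n × n` block of `u`. Both operations then have closed formulas. By `eval_mul`, the value of a
product at `u` is a sum over the ways to cut `n` as `a + b`, with the second factor evaluated at
`shift a u`. By `eval₂_comul`, the value of a coproduct at `(u, v)` is a sum over the sets `A` of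
`s` elements among the first `s + t` numbers, evaluated at the matrix `merge` that interleaves `u`
on `A` with `v` off `A`.

By `TensorProduct.separating_of_separating`, evaluations also separate points of tensor powers, so
the axioms become bijections of index sets. Coassociativity holds because both iterated coproducts
sum over ordered partitions of an interval into three sets (`merge_merge`, `coassoc_eval`). The
coproduct is multiplicative because cutting an interval splits a subset into two, and the diagonal
blocks of a merge are merges of diagonal blocks (`shift_merge`, `comul_mul`). Cocommutativity is
passage to the complement.

The bialgebra is graded with degree zero spanned by the unit, so the identity has a convolution
inverse given by a geometric series that is finite in each degree (`exists_graded_antipode`). -/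

/-- Upper triangular matrices with rows and columns indexed by `ℕ` and ones on the diagonal. -/
def InfUT (F : Type*) [Field F] : Type _ :=
  {u : ℕ → ℕ → F // (∀ i, u i i = 1) ∧ ∀ i j, j < i → u i j = 0}

namespace InfUT

variable {F : Type*} [Field F]

@[ext]
theorem ext {u v : InfUT F} (h : ∀ i j, u.1 i j = v.1 i j) : u = v :=
  Subtype.ext (funext fun i => funext fun j => h i j)

/-- The identity matrix. -/
instance : One (InfUT F) :=
  ⟨⟨fun i j => if i = j then 1 else 0, fun _ => if_pos rfl, fun _ _ h => if_neg h.ne.symm⟩⟩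

/-- The upper left `n × n` block. -/
def trunc (n : ℕ) (u : InfUT F) : UT n F :=
  ⟨fun i j => u.1 i j, fun i => u.2.1 i, fun i j h => u.2.2 i j h⟩

/-- The matrix obtained by deleting the first `a` rows and columns. -/
def shift (a : ℕ) (u : InfUT F) : InfUT F :=
  ⟨fun i j => u.1 (a + i) (a + j), fun i => u.2.1 _, fun i j h => u.2.2 _ _ (by omega)⟩

/-- The matrix whose rows and columns in `P` form `u`, whose other rows and columns form `v`, and
whose remaining entries are zero. -/
def merge (P : ℕ → Prop) [DecidablePred P] (u v : InfUT F) : InfUT F :=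
  ⟨fun i j => if P i then (if P j then u.1 (Nat.count P i) (Nat.count P j) else 0)
      else (if P j then 0 else v.1 (Nat.count (fun k => ¬ P k) i) (Nat.count (fun k => ¬ P k) j)),
    fun i => by dsimp only; split_ifs <;> simp [u.2.1, v.2.1], fun i j h => by
      dsimp only
      split_ifs with hi hj hj
      · exact u.2.2 _ _ (Nat.count_strict_mono hj h)
      · rfl
      · rfl
      · exact v.2.2 _ _ (Nat.count_strict_mono (p := fun k => ¬ P k) hj h)⟩

theorem trunc_congr {n : ℕ} {u v : InfUT F} (h : ∀ i < n, ∀ j < n, u.1 i j = v.1 i j) :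
    trunc n u = trunc n v :=
  Subtype.ext <| funext fun i => funext fun j => h i i.2 j j.2

theorem trunc_surjective (n : ℕ) : Function.Surjective (trunc n : InfUT F → UT n F) := by
  intro u
  -- The finite matrix is extended by the identity.
  refine ⟨⟨fun i j => if h : i < n ∧ j < n then u.1 ⟨i, h.1⟩ ⟨j, h.2⟩ else if i = j then 1 else 0,
    fun i => ?_, fun i j h => ?_⟩, ?_⟩
  · dsimp only
    split_ifs with h h'
    · exact u.2.1 _
    · rfl
    · exact absurd rfl h'
  · dsimp only
    split_ifs with h1 h2
    · exact u.2.2 _ _ h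
    · omega
    · rfl
  · exact Subtype.ext <| funext fun i => funext fun j => dif_pos ⟨i.2, j.2⟩

theorem upperBlock_trunc (a b : ℕ) (u : InfUT F) :
    UT.upperBlock (trunc (a + b) u) = trunc a u := rfl

theorem lowerBlock_trunc (a b : ℕ) (u : InfUT F) :
    UT.lowerBlock (trunc (a + b) u) = trunc b (shift a u) := rfl

@[simp]
theorem shift_zero (u : InfUT F) : shift 0 u = u := by
  ext i j; simp [shift]

theorem shift_shift (a b : ℕ) (u : InfUT F) : shift b (shift a u) = shift (a + b) u := by
  ext i j; simp [shift, add_assoc]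

end InfUT

/-! ### Ranks of elements in subsets of ℕ -/

theorem Nat.count_congr_of_lt {P Q : ℕ → Prop} [DecidablePred P] [DecidablePred Q] {n : ℕ}
    (h : ∀ k < n, (P k ↔ Q k)) : Nat.count P n = Nat.count Q n :=
  le_antisymm (Nat.count_mono_left fun k hk => (h k hk).1)
    (Nat.count_mono_left fun k hk => (h k hk).2)

/-- `Nat.count P` gives the rank in the set `P`; counting by `Q` among ranks selects a subset of
`P`, and this computes the rank in that subset. -/
theorem Nat.count_count (P Q : ℕ → Prop) [DecidablePred P] [DecidablePred Q] (n : ℕ) :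
    Nat.count Q (Nat.count P n) = Nat.count (fun k => P k ∧ Q (Nat.count P k)) n := by
  induction n with
  | zero => simp
  | succ n ih =>
    by_cases h : P n <;> simp [Nat.count_succ, h, ih]

/-- The elements of `B` below its `i`-th element are the images of the indices below `i`. This
connects the order embeddings used in straightening with the ranks used in `InfUT.merge`. -/
theorem Finset.count_orderEmbOfFin {n : ℕ} (B : Finset (Fin n)) (Q : ℕ → Prop) [DecidablePred Q]
    (hQ : ∀ j : Fin n, Q j ↔ j ∈ B) (i : Fin B.card) :
    Nat.count Q (B.orderEmbOfFin rfl i) = i := by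
  have : (Finset.range (B.orderEmbOfFin rfl i)).filter Q =
      (Finset.univ.filter (· < i)).map
        ((B.orderEmbOfFin rfl).toEmbedding.trans Fin.valEmbedding) := by
    ext k
    simp only [Finset.mem_filter, Finset.mem_range, Finset.mem_map, Finset.mem_univ, true_and]
    constructor
    · rintro ⟨hk, hQk⟩
      have hkn : k < n := hk.trans (Fin.is_lt _)
      have hkB : (⟨k, hkn⟩ : Fin n) ∈ B := (hQ ⟨k, hkn⟩).1 hQk
      rw [← Finset.mem_coe, ← Finset.range_orderEmbOfFin B rfl] at hkB
      obtain ⟨j, hj⟩ := hkB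
      refine ⟨j, ?_, ?_⟩
      · rw [← (B.orderEmbOfFin rfl).lt_iff_lt, hj]
        exact hk
      · simp [hj]
    · rintro ⟨j, hj, rfl⟩
      exact ⟨(B.orderEmbOfFin rfl).lt_iff_lt.2 hj,
        (hQ _).2 (Finset.orderEmbOfFin_mem B rfl j)⟩
  rw [Nat.count_eq_card_filter_range, this, Finset.card_map, Finset.filter_gt_eq_Iio, Fin.card_Iio]

/-! ### Merging matrices along a subset -/

namespace InfUT

variable {F : Type*} [Field F]

theorem straightenInv_trunc {n : ℕ} (A : Finset (Fin n)) (P : ℕ → Prop) [DecidablePred P]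
    (hP : ∀ j : Fin n, P j ↔ j ∈ A) (u v : InfUT F) :
    UT.straightenInv A (trunc A.card u, trunc Aᶜ.card v) = trunc n (merge P u v) := by
  have hP' : ∀ j : Fin n, ¬ P j ↔ j ∈ Aᶜ := fun j => by simp [hP]
  refine Subtype.ext <| funext fun i => funext fun j => ?_
  have hc := A.count_orderEmbOfFin P hP
  have hc' := Aᶜ.count_orderEmbOfFin (fun k => ¬ P k) hP'
  have h1 : ∀ k, P (A.orderEmbOfFin rfl k) := fun k =>
    (hP _).2 (Finset.orderEmbOfFin_mem A rfl k)
  have h2 : ∀ k, ¬ P (Aᶜ.orderEmbOfFin rfl k) := fun k =>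
    (hP' _).2 (Finset.orderEmbOfFin_mem Aᶜ rfl k)
  obtain ⟨i | i, rfl⟩ := (finSumEquivOfFinset (s := A) rfl rfl).surjective i <;>
  obtain ⟨j | j, rfl⟩ := (finSumEquivOfFinset (s := A) rfl rfl).surjective j <;>
  simp only [UT.straightenInv, Matrix.reindex_apply, Matrix.submatrix_apply,
    Equiv.symm_apply_apply, Matrix.fromBlocks_apply₁₁, Matrix.fromBlocks_apply₁₂,
    Matrix.fromBlocks_apply₂₁, Matrix.fromBlocks_apply₂₂, Matrix.zero_apply] <;>
  simp only [trunc, merge, finSumEquivOfFinset_inl, finSumEquivOfFinset_inr, h1, h2, hc, hc',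
    if_true, if_false]

/-- The rank of `a + k` is the rank of `a` plus the rank of `k` in the translated set. Hence a lower
diagonal block of a merge is again a merge, of lower blocks of the two matrices. This is the matrix
side of the multiplicativity of the coproduct. -/
theorem shift_merge (a : ℕ) (P Q : ℕ → Prop) [DecidablePred P] [DecidablePred Q]
    (h : ∀ k, Q k ↔ P (a + k)) (u v : InfUT F) :
    shift a (merge P u v) =
      merge Q (shift (Nat.count P a) u) (shift (Nat.count (fun k => ¬ P k) a) v) := by
  obtain rfl : Q = fun k => P (a + k) := funext fun k => propext (h k)
  ext i j
  simp only [shift, merge, Nat.count_add]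
  split_ifs <;> first | rfl | congr!

theorem merge_congr {P Q : ℕ → Prop} [DecidablePred P] [DecidablePred Q] {n : ℕ}
    (h : ∀ k < n, (P k ↔ Q k)) (u v : InfUT F) :
    trunc n (merge P u v) = trunc n (merge Q u v) := by
  refine trunc_congr fun i hi j hj => ?_
  have h' : ∀ k < n, (¬ P k ↔ ¬ Q k) := fun k hk => not_congr (h k hk)
  simp only [merge, h i hi, h j hj,
    Nat.count_congr_of_lt fun k hk => h k (hk.trans hi),
    Nat.count_congr_of_lt fun k hk => h k (hk.trans hj),
    Nat.count_congr_of_lt fun k hk => h' k (hk.trans hi),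
    Nat.count_congr_of_lt fun k hk => h' k (hk.trans hj)]

theorem merge_not {P Q : ℕ → Prop} [DecidablePred P] [DecidablePred Q] {n : ℕ}
    (h : ∀ k < n, (P k ↔ ¬ Q k)) (u v : InfUT F) :
    trunc n (merge P u v) = trunc n (merge Q v u) := by
  rw [merge_congr h]
  refine trunc_congr fun i hi j hj => ?_
  simp only [merge, ite_not, not_not]

theorem merge_false (P : ℕ → Prop) [DecidablePred P] {n : ℕ} (h : ∀ k < n, ¬ P k)
    (u v : InfUT F) : trunc n (merge P u v) = trunc n v := by
  rw [merge_congr (Q := fun _ => False) (by simpa using h)]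
  refine trunc_congr fun i hi j hj => ?_
  simp [merge]

theorem merge_true (P : ℕ → Prop) [DecidablePred P] {n : ℕ} (h : ∀ k < n, P k)
    (u v : InfUT F) : trunc n (merge P u v) = trunc n u := by
  rw [merge_not (Q := fun _ => False) (by simpa using h), merge_false _ (by simp)]

/-- Both sides place `u`, `v`, `w` on three disjoint sets covering the indices below `n`: `P'`, the
rest of `P`, and the complement of `P`. The predicate `Q` finds `P'` by ranks inside `P`, and `Q'`
finds the rest of `P` by ranks outside `P'`. -/
theorem merge_merge (P Q P' Q' : ℕ → Prop) [DecidablePred P] [DecidablePred Q]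
    [DecidablePred P'] [DecidablePred Q'] {n : ℕ}
    (h : ∀ k < n, (P' k ↔ P k ∧ Q (Nat.count P k)))
    (h' : ∀ k < n, ¬ P' k → (Q' (Nat.count (fun k => ¬ P' k) k) ↔ P k)) (u v w : InfUT F) :
    trunc n (merge P (merge Q u v) w) = trunc n (merge P' u (merge Q' v w)) := by
  refine trunc_congr fun i hi j hj => ?_
  -- `e1`, `e2`, `e3` say that the two sides use the same ranks in the sets carrying `u`, `v`, `w`
  -- respectively.
  have e1 : ∀ k < n, Nat.count Q (Nat.count P k) = Nat.count P' k := fun k hk => by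
    rw [Nat.count_count]
    exact Nat.count_congr_of_lt fun l hl => (h l (hl.trans hk)).symm
  have e2 : ∀ k < n, Nat.count (fun l => ¬ Q l) (Nat.count P k) =
      Nat.count Q' (Nat.count (fun l => ¬ P' l) k) := fun k hk => by
    rw [Nat.count_count, Nat.count_count]
    refine Nat.count_congr_of_lt fun l hl => ?_
    have h1 := h l (hl.trans hk)
    have h2 := h' l (hl.trans hk)
    tauto
  have e3 : ∀ k < n, Nat.count (fun l => ¬ P l) k =
      Nat.count (fun l => ¬ Q' l) (Nat.count (fun l => ¬ P' l) k) := fun k hk => by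
    rw [Nat.count_count (fun l => ¬ P' l)]
    refine Nat.count_congr_of_lt fun l hl => ?_
    have h1 := h l (hl.trans hk)
    have h2 := h' l (hl.trans hk)
    tauto
  have hi1 := h i hi
  have hi2 := h' i hi
  have hj1 := h j hj
  have hj2 := h' j hj
  simp only [merge, e1 i hi, e1 j hj, e2 i hi, e2 j hj, e3 i hi, e3 j hj]
  by_cases a1 : P i <;> by_cases a2 : P j <;> by_cases a3 : P' i <;> by_cases a4 : P' j <;>
    simp_all

end InfUT

/-! ### Separating families of functionals -/

/-- Write the tensor as `∑ cᵢ ⊗ Bᵢ` with `B` a basis of `W`. For fixed `p`, every `g q` kills `∑ f p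
cᵢ • Bᵢ`, so this vector is zero and each `f p cᵢ` vanishes; letting `p` vary gives `cᵢ = 0`. -/
theorem TensorProduct.separating_of_separating {k V W P Q : Type*} [Field k] [AddCommGroup V]
    [Module k V] [AddCommGroup W] [Module k W] {f : P → V →ₗ[k] k} {g : Q → W →ₗ[k] k}
    (hf : ∀ x, (∀ p, f p x = 0) → x = 0) (hg : ∀ y, (∀ q, g q y = 0) → y = 0)
    (t : V ⊗[k] W) (ht : ∀ p q, LinearMap.mul' k k (TensorProduct.map (f p) (g q) t) = 0) :
    t = 0 := by
  let B := Module.Basis.ofVectorSpace k W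
  obtain ⟨c, rfl⟩ := TensorProduct.eq_repr_basis_right B t
  suffices hc : c = 0 by simp [hc]
  ext i
  refine hf _ fun p => ?_
  have h0 : (c.mapRange (f p) (map_zero _)).sum (fun i r => r • B i) = 0 := by
    refine hg _ fun q => ?_
    have := ht p q
    rw [Finsupp.sum_mapRange_index (by simp)]
    simpa [Finsupp.sum, map_sum] using this
  have := linearIndependent_iff.1 B.linearIndependent _ h0
  simpa using DFunLike.congr_fun this i

/-! ### Product and coproduct in terms of values -/

namespace SC

variable {F : Type*} [Field F]

/-- The value at an infinite matrix, truncated to size `n`. -/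
def eval (n : ℕ) (u : InfUT F) : SC F →ₗ[ℂ] ℂ :=
  LinearMap.proj (InfUT.trunc n u) ∘ₗ (SuperclassFun n F).subtype ∘ₗ
    DirectSum.component ℂ ℕ (fun n => SuperclassFun n F) n

theorem eval_of (n m : ℕ) (u : InfUT F) (χ : SuperclassFun m F) :
    eval n u (of F m χ) = if n = m then χ.1 (InfUT.trunc m u) else 0 := by
  split_ifs with h
  · subst h
    simp [eval, of, DirectSum.component.lof_self]
  · simp [eval, of, DirectSum.component.of, Ne.symm h]

theorem eval_congr {n : ℕ} {u v : InfUT F} (h : InfUT.trunc n u = InfUT.trunc n v) (x : SC F) :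
    eval n u x = eval n v x := by
  simp [eval, h]

@[elab_as_elim]
theorem induction_on {p : SC F → Prop} (x : SC F) (of : ∀ n χ, p (SC.of F n χ))
    (add : ∀ x y, p x → p y → p (x + y)) : p x :=
  DirectSum.induction_on x (by simpa using of 0 0) of add

theorem eq_zero_of_eval (x : SC F) (h : ∀ p : ℕ × InfUT F, eval p.1 p.2 x = 0) : x = 0 := by
  refine DFinsupp.ext fun n => Subtype.ext <| funext fun u => ?_
  obtain ⟨u, rfl⟩ := InfUT.trunc_surjective n u
  exact h (n, u)

/-- The value of a tensor at a pair of infinite matrices, truncated to sizes `s` and `t`. -/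
def eval₂ (s : ℕ) (u : InfUT F) (t : ℕ) (v : InfUT F) : SC F ⊗[ℂ] SC F →ₗ[ℂ] ℂ :=
  LinearMap.mul' ℂ ℂ ∘ₗ TensorProduct.map (eval s u) (eval t v)

@[simp]
theorem eval₂_tmul (s : ℕ) (u : InfUT F) (t : ℕ) (v : InfUT F) (x y : SC F) :
    eval₂ s u t v (x ⊗ₜ y) = eval s u x * eval t v y := rfl

theorem mul_of_of (a b : ℕ) (χ : SuperclassFun a F) (ψ : SuperclassFun b F) :
    SC.mul F (of F a χ) (of F b ψ) =
      of F (a + b) (SuperclassFun.inflation a b F (SuperclassFun.cross a b F χ ψ)) := by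
  simp [SC.mul, of]

theorem eval_one (n : ℕ) (u : InfUT F) : eval n u (SC.one F) = if n = 0 then 1 else 0 := by
  rw [SC.one, eval_of]

/-- For homogeneous factors of degrees `a` and `b` only the cut `(a, b)` can contribute. Summing
over all cuts makes the formula bilinear, hence valid for inhomogeneous elements. -/
theorem eval_mul (n : ℕ) (u : InfUT F) (x y : SC F) :
    eval n u (SC.mul F x y) = ∑ p ∈ Finset.HasAntidiagonal.antidiagonal n,
      eval p.1 u x * eval p.2 (InfUT.shift p.1 u) y := by
  induction x using SC.induction_on with
  | add x x' hx hx' => simp [hx, hx', add_mul, Finset.sum_add_distrib]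
  | of a χ =>
    induction y using SC.induction_on with
    | add y y' hy hy' => simp [hy, hy', mul_add, Finset.sum_add_distrib]
    | of b ψ =>
      rw [mul_of_of, eval_of]
      simp only [eval_of]
      split_ifs with h
      · subst h
        rw [Finset.sum_eq_single (a, b)]
        · simp [SuperclassFun.inflation, SuperclassFun.cross, InfUT.upperBlock_trunc,
            InfUT.lowerBlock_trunc]
        · rintro ⟨a', b'⟩ h1 h2
          rw [Finset.HasAntidiagonal.mem_antidiagonal] at h1
          dsimp only at h1 ⊢
          by_cases h3 : a' = a
          · subst h3
            obtain rfl : b' = b := by omega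
            exact absurd rfl h2
          · simp [h3]
        · simp
      · refine (Finset.sum_eq_zero ?_).symm
        rintro ⟨a', b'⟩ h1
        rw [Finset.HasAntidiagonal.mem_antidiagonal] at h1
        dsimp only at h1 ⊢
        split_ifs with h2 h3
        · omega
        · simp
        · simp
        · simp

theorem eval₂_map_tensorEquiv_symm [Finite F] (a b s t : ℕ) (u v : InfUT F)
    (G : SuperclassFunProd a b F) :
    eval₂ s u t v (TensorProduct.map (of F a) (of F b)
      ((SuperclassFun.tensorEquiv a b F).symm G)) =
      if s = a ∧ t = b then G.1 (InfUT.trunc a u, InfUT.trunc b v) else 0 := by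
  -- The inverse of the identification has no explicit formula, so `G` is written as the image of a
  -- tensor, where pure tensors suffice.
  obtain ⟨z, rfl⟩ := (SuperclassFun.tensorEquiv a b F).surjective G
  rw [LinearEquiv.symm_apply_apply]
  induction z using TensorProduct.induction_on with
  | zero => simp
  | add x y hx hy =>
    simp only [map_add, hx, hy, Submodule.coe_add, Pi.add_apply]
    split_ifs <;> simp
  | tmul χ ψ =>
    simp only [TensorProduct.map_tmul, eval₂_tmul, eval_of]
    by_cases h1 : s = a <;> by_cases h2 : t = b <;>
      simp [h1, h2, SuperclassFun.tensorEquiv, SuperclassFun.cross]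

theorem comul_of [Finite F] (n : ℕ) (χ : SuperclassFun n F) :
    SC.comul F (of F n χ) = ∑ A : Finset (Fin n),
      TensorProduct.map (of F A.card) (of F Aᶜ.card)
        ((SuperclassFun.tensorEquiv A.card Aᶜ.card F).symm (SuperclassFun.restriction F A χ)) := by
  simp [SC.comul, of]

theorem eval₂_comul [Finite F] (s t : ℕ) (u v : InfUT F) (x : SC F) :
    eval₂ s u t v (SC.comul F x) = ∑ A ∈ Finset.powersetCard s (Finset.range (s + t)),
      eval (s + t) (InfUT.merge (· ∈ A) u v) x := by
  induction x using SC.induction_on with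
  | add x y hx hy => simp [hx, hy, Finset.sum_add_distrib]
  | of n χ =>
    rw [comul_of, map_sum]
    simp only [eval₂_map_tensorEquiv_symm, eval_of]
    by_cases h : s + t = n
    · subst h
      -- Subsets of `Fin (s + t)` are moved to subsets of ℕ, where sets from different ambient
      -- intervals can be compared.
      have h1 : Finset.powersetCard s (Finset.range (s + t)) =
          (Finset.powersetCard s (Finset.univ : Finset (Fin (s + t)))).map
            (Finset.mapEmbedding Fin.valEmbedding).toEmbedding := by
        rw [← Finset.powersetCard_map, Fin.map_valEmbedding_univ, Nat.Iio_eq_range]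
      rw [h1, Finset.sum_map, ← Finset.sum_filter]
      refine Finset.sum_congr ?_ fun A hA => ?_
      · ext A
        have := A.card_add_card_compl
        rw [Fintype.card_fin] at this
        simp only [Finset.mem_filter, Finset.mem_univ, true_and, Finset.mem_powersetCard,
          Finset.subset_univ]
        omega
      · rw [if_pos rfl, ← InfUT.straightenInv_trunc A]
        · rfl
        · intro j
          simp [Finset.mapEmbedding_apply, Fin.val_inj]
    · simp only [if_neg h, Finset.sum_const_zero]
      refine Finset.sum_eq_zero fun A _ => if_neg ?_
      have := A.card_add_card_compl
      rw [Fintype.card_fin] at this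
      omega

theorem counit_eq_eval : SC.counit F = eval 0 1 := by
  have : InfUT.trunc 0 (1 : InfUT F) = 1 := Subtype.ext (Subsingleton.elim _ _)
  rw [eval, this]
  rfl

end SC

/-- The space `SC`, as the carrier of the Hopf algebra. -/
def SCHopf (F : Type u) [Field F] : Type u := SC F

/-! ### Evaluation functionals and the ring structure -/

namespace SCHopf

variable {F : Type*} [Field F]

instance : AddCommGroup (SCHopf F) := inferInstanceAs (AddCommGroup (SC F))

instance : Module ℂ (SCHopf F) := inferInstanceAs (Module ℂ (SC F))

variable (F) in
/-- The identity map from `SC F` to `SCHopf F`. -/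
def equiv : SC F ≃ₗ[ℂ] SCHopf F where
  toFun x := x
  map_add' _ _ := rfl
  map_smul' _ _ := rfl
  invFun x := x

/-- The value at an infinite matrix, truncated to size `n`. -/
def eval (n : ℕ) (u : InfUT F) : SCHopf F →ₗ[ℂ] ℂ := SC.eval n u ∘ₗ (equiv F).symm.toLinearMap

@[simp]
theorem eval_equiv (n : ℕ) (u : InfUT F) (x : SC F) : eval n u (equiv F x) = SC.eval n u x := rfl

theorem eval_congr {n : ℕ} {u v : InfUT F} (h : InfUT.trunc n u = InfUT.trunc n v)
    (x : SCHopf F) : eval n u x = eval n v x := SC.eval_congr h _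

theorem eq_zero_of_eval (x : SCHopf F) (h : ∀ p : ℕ × InfUT F, eval p.1 p.2 x = 0) : x = 0 :=
  SC.eq_zero_of_eval ((equiv F).symm x) h

theorem ext_eval {x y : SCHopf F} (h : ∀ n u, eval n u x = eval n u y) : x = y :=
  sub_eq_zero.1 <| eq_zero_of_eval _ fun p => by rw [map_sub, h, sub_self]

/-- The value of a tensor at a pair of infinite matrices, truncated to sizes `s` and `t`. -/
def eval₂ (s : ℕ) (u : InfUT F) (t : ℕ) (v : InfUT F) : SCHopf F ⊗[ℂ] SCHopf F →ₗ[ℂ] ℂ :=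
  LinearMap.mul' ℂ ℂ ∘ₗ TensorProduct.map (eval s u) (eval t v)

@[simp]
theorem eval₂_tmul (s : ℕ) (u : InfUT F) (t : ℕ) (v : InfUT F) (x y : SCHopf F) :
    eval₂ s u t v (x ⊗ₜ y) = eval s u x * eval t v y := rfl

theorem eq_zero_of_eval₂ (x : SCHopf F ⊗[ℂ] SCHopf F)
    (h : ∀ p q : ℕ × InfUT F, eval₂ p.1 p.2 q.1 q.2 x = 0) : x = 0 :=
  TensorProduct.separating_of_separating eq_zero_of_eval eq_zero_of_eval x h

theorem ext_eval₂ {x y : SCHopf F ⊗[ℂ] SCHopf F}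
    (h : ∀ s u t v, eval₂ s u t v x = eval₂ s u t v y) : x = y :=
  sub_eq_zero.1 <| eq_zero_of_eval₂ _ fun p q => by rw [map_sub, h, sub_self]

/-- The value of a tensor at a triple of infinite matrices, truncated to sizes `s`, `t`, `r`. -/
def eval₃ (s : ℕ) (u : InfUT F) (t : ℕ) (v : InfUT F) (r : ℕ) (w : InfUT F) :
    SCHopf F ⊗[ℂ] (SCHopf F ⊗[ℂ] SCHopf F) →ₗ[ℂ] ℂ :=
  LinearMap.mul' ℂ ℂ ∘ₗ TensorProduct.map (eval s u) (eval₂ t v r w)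

@[simp]
theorem eval₃_tmul (s : ℕ) (u : InfUT F) (t : ℕ) (v : InfUT F) (r : ℕ) (w : InfUT F)
    (x : SCHopf F) (y : SCHopf F ⊗[ℂ] SCHopf F) :
    eval₃ s u t v r w (x ⊗ₜ y) = eval s u x * eval₂ t v r w y := rfl

theorem ext_eval₃ {x y : SCHopf F ⊗[ℂ] (SCHopf F ⊗[ℂ] SCHopf F)}
    (h : ∀ s u t v r w, eval₃ s u t v r w x = eval₃ s u t v r w y) : x = y :=
  sub_eq_zero.1 <| TensorProduct.separating_of_separating
    (f := fun p : ℕ × InfUT F => eval p.1 p.2)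
    (g := fun q : (ℕ × InfUT F) × (ℕ × InfUT F) => eval₂ q.1.1 q.1.2 q.2.1 q.2.2)
    eq_zero_of_eval (fun x h => eq_zero_of_eval₂ x fun p q => h (p, q)) _
    fun p q => by
      have := h p.1 p.2 q.1.1 q.1.2 q.2.1 q.2.2
      rw [eval₃, LinearMap.comp_apply, LinearMap.comp_apply] at this
      rw [map_sub, map_sub, this, sub_self]

instance : Mul (SCHopf F) :=
  ⟨fun x y => equiv F (SC.mul F ((equiv F).symm x) ((equiv F).symm y))⟩

instance : One (SCHopf F) := ⟨equiv F (SC.one F)⟩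

instance [Finite F] : CoalgebraStruct ℂ (SCHopf F) where
  comul := TensorProduct.map (equiv F).toLinearMap (equiv F).toLinearMap ∘ₗ SC.comul F ∘ₗ
    (equiv F).symm.toLinearMap
  counit := SC.counit F ∘ₗ (equiv F).symm.toLinearMap

theorem eval_one (n : ℕ) (u : InfUT F) : eval n u (1 : SCHopf F) = if n = 0 then 1 else 0 :=
  SC.eval_one n u

theorem eval_mul (n : ℕ) (u : InfUT F) (x y : SCHopf F) :
    eval n u (x * y) = ∑ p ∈ Finset.HasAntidiagonal.antidiagonal n,
      eval p.1 u x * eval p.2 (InfUT.shift p.1 u) y :=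
  SC.eval_mul n u _ _

theorem counit_eq_eval [Finite F] (u : InfUT F) (x : SCHopf F) :
    Coalgebra.counit (R := ℂ) x = eval 0 u x := by
  rw [eval_congr (v := 1) (Subtype.ext (Subsingleton.elim _ _))]
  exact DFunLike.congr_fun SC.counit_eq_eval _

theorem eval₂_comul [Finite F] (s t : ℕ) (u v : InfUT F) (x : SCHopf F) :
    eval₂ s u t v (Coalgebra.comul (R := ℂ) x) =
      ∑ A ∈ Finset.powersetCard s (Finset.range (s + t)),
        eval (s + t) (InfUT.merge (· ∈ A) u v) x := by
  refine Eq.trans ?_ (SC.eval₂_comul s t u v ((equiv F).symm x))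
  have h : eval₂ s u t v ∘ₗ TensorProduct.map (equiv F).toLinearMap (equiv F).toLinearMap =
      SC.eval₂ s u t v := TensorProduct.ext' fun _ _ => rfl
  rw [← h]
  rfl

instance : Ring (SCHopf F) where
  __ := (inferInstance : AddCommGroup (SCHopf F))
  mul_assoc x y z := by
    refine ext_eval fun n u => ?_
    simp only [eval_mul, Finset.sum_mul, Finset.mul_sum, InfUT.shift_shift]
    rw [Finset.sum_sigma', Finset.sum_sigma']
    -- Both sides are sums over the ways to cut `n` into three consecutive intervals.
    refine Finset.sum_nbij' (fun ⟨⟨_, k⟩, ⟨i, j⟩⟩ ↦ ⟨(i, j + k), (j, k)⟩)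
      (fun ⟨⟨i, _⟩, ⟨j, k⟩⟩ ↦ ⟨(i + j, k), (i, j)⟩) ?_ ?_ ?_ ?_ ?_ <;>
    rintro ⟨⟨a, b⟩, ⟨c, d⟩⟩ <;>
    simp only [Finset.mem_sigma, Finset.HasAntidiagonal.mem_antidiagonal, and_imp] <;>
    rintro h1 h2
    · exact ⟨by omega, trivial⟩
    · exact ⟨by omega, trivial⟩
    · subst h2; rfl
    · subst h2; rfl
    · subst h2; exact mul_assoc _ _ _
  one_mul x := ext_eval fun n u => by
    rw [eval_mul, Finset.sum_eq_single (0, n)]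
    · simp [eval_one]
    · rintro ⟨a, b⟩ h1 h2
      rw [Finset.HasAntidiagonal.mem_antidiagonal] at h1
      dsimp only at h1 ⊢
      rw [eval_one, if_neg, zero_mul]
      rintro rfl
      exact h2 (by simp_all)
    · simp
  mul_one x := ext_eval fun n u => by
    rw [eval_mul, Finset.sum_eq_single (n, 0)]
    · simp [eval_one]
    · rintro ⟨a, b⟩ h1 h2
      rw [Finset.HasAntidiagonal.mem_antidiagonal] at h1
      dsimp only at h1 ⊢
      rw [eval_one, if_neg, mul_zero]
      rintro rfl
      exact h2 (by simp_all)
    · simp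
  left_distrib x y z := ext_eval fun n u => by
    simp [eval_mul, mul_add, Finset.sum_add_distrib]
  right_distrib x y z := ext_eval fun n u => by
    simp [eval_mul, add_mul, Finset.sum_add_distrib]
  zero_mul x := ext_eval fun n u => by simp [eval_mul]
  mul_zero x := ext_eval fun n u => by simp [eval_mul]

instance : Algebra ℂ (SCHopf F) :=
  Algebra.ofModule
    (fun c x y => ext_eval fun n u => by simp [eval_mul, Finset.mul_sum, mul_assoc])
    (fun c x y => ext_eval fun n u => by simp [eval_mul, Finset.mul_sum, mul_left_comm])

end SCHopf

/-! ### Sums over finite sets of natural numbers -/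

theorem Nat.count_add_count_not (P : ℕ → Prop) [DecidablePred P] (n : ℕ) :
    Nat.count P n + Nat.count (fun k => ¬ P k) n = n := by
  simp only [Nat.count_eq_card_filter_range]
  rw [Finset.card_filter_add_card_filter_not, Finset.card_range]

theorem Nat.count_eq_card {B : Finset ℕ} {N : ℕ} (hB : B ⊆ Finset.range N) {Q : ℕ → Prop}
    [DecidablePred Q] (hQ : ∀ k < N, (Q k ↔ k ∈ B)) : Nat.count Q N = B.card := by
  rw [Nat.count_eq_card_filter_range]
  congr 1
  ext k
  rw [Finset.mem_filter, Finset.mem_range]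
  exact ⟨fun h => (hQ k h.1).1 h.2, fun h =>
    ⟨Finset.mem_range.1 (hB h), (hQ k (Finset.mem_range.1 (hB h))).2 h⟩⟩

/-- `Nat.count Q` maps `B` in increasing order onto the first `B.card` numbers, so taking images
matches the subsets of `B` with subsets of that interval. -/
theorem Finset.sum_powersetCard_range_card {M : Type*} [AddCommMonoid M] {B : Finset ℕ} {N : ℕ}
    (hB : B ⊆ Finset.range N) (Q : ℕ → Prop) [DecidablePred Q] (hQ : ∀ k < N, (Q k ↔ k ∈ B))
    (s : ℕ) (h : Finset ℕ → M) :
    ∑ A ∈ Finset.powersetCard s (Finset.range B.card), h A =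
      ∑ X ∈ Finset.powersetCard s B, h (X.image (Nat.count Q)) := by
  have hBQ : ∀ k ∈ B, Q k := fun k hk => (hQ k (Finset.mem_range.1 (hB hk))).2 hk
  have hinj : Set.InjOn (Nat.count Q) (B : Set ℕ) := fun k hk l hl hkl =>
    Nat.count_injective (hBQ k hk) (hBQ l hl) hkl
  have himage : B.image (Nat.count Q) = Finset.range B.card := by
    refine Finset.eq_of_subset_of_card_le (fun k hk => ?_) ?_
    · obtain ⟨l, hl, rfl⟩ := Finset.mem_image.1 hk
      rw [Finset.mem_range, ← Nat.count_eq_card hB hQ]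
      exact Nat.count_strict_mono (hBQ l hl) (Finset.mem_range.1 (hB hl))
    · rw [Finset.card_image_of_injOn hinj, Finset.card_range]
  have hleft : ∀ A ⊆ Finset.range B.card,
      (B.filter fun k => Nat.count Q k ∈ A).image (Nat.count Q) = A := fun A hA => by
    ext k
    simp only [Finset.mem_image, Finset.mem_filter]
    constructor
    · rintro ⟨l, ⟨_, hl⟩, rfl⟩
      exact hl
    · intro hk
      obtain ⟨l, hl, rfl⟩ := Finset.mem_image.1 (himage ▸ hA hk)
      exact ⟨l, ⟨hl, hk⟩, rfl⟩
  have hsub : ∀ X ⊆ B, Set.InjOn (Nat.count Q) (X : Set ℕ) := fun X hX =>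
    hinj.mono (Finset.coe_subset.2 hX)
  refine Finset.sum_bij' (fun A _ => B.filter fun k => Nat.count Q k ∈ A)
    (fun X _ => X.image (Nat.count Q)) ?_ ?_ ?_ ?_ ?_
  · intro A hA
    rw [Finset.mem_powersetCard] at hA ⊢
    refine ⟨Finset.filter_subset _ _, ?_⟩
    rw [← Finset.card_image_of_injOn (hsub _ (Finset.filter_subset _ _)), hleft A hA.1, hA.2]
  · intro X hX
    rw [Finset.mem_powersetCard] at hX ⊢
    exact ⟨himage ▸ Finset.image_subset_image hX.1,
      (Finset.card_image_of_injOn (hsub X hX.1)).trans hX.2⟩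
  · intro A hA
    exact hleft A (Finset.mem_powersetCard.1 hA).1
  · intro X hX
    have hX := (Finset.mem_powersetCard.1 hX).1
    ext k
    simp only [Finset.mem_image, Finset.mem_filter]
    constructor
    · rintro ⟨hk, l, hl, hlk⟩
      exact hinj (hX hl) hk hlk ▸ hl
    · exact fun hk => ⟨hX hk, k, hk, rfl⟩
  · intro A hA
    rw [hleft A (Finset.mem_powersetCard.1 hA).1]

/-- Both sides run over disjoint pairs `(X, Y)` in `U` of sizes `s` and `t`, with `B = X ∪ Y`. -/
theorem Finset.sum_powersetCard_powersetCard {M : Type*} [AddCommMonoid M] (s t : ℕ)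
    (U : Finset ℕ) (g : Finset ℕ → Finset ℕ → M) :
    ∑ B ∈ Finset.powersetCard (s + t) U, ∑ X ∈ Finset.powersetCard s B, g X (B \ X) =
      ∑ X ∈ Finset.powersetCard s U, ∑ Y ∈ Finset.powersetCard t (U \ X), g X Y := by
  rw [Finset.sum_sigma', Finset.sum_sigma']
  refine Finset.sum_bij' (fun p _ => ⟨p.2, p.1 \ p.2⟩) (fun p _ => ⟨p.1 ∪ p.2, p.1⟩)
    ?_ ?_ ?_ ?_ ?_
  · rintro ⟨B, X⟩ h
    simp only [Finset.mem_sigma, Finset.mem_powersetCard] at h ⊢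
    obtain ⟨⟨h1, h2⟩, h3, h4⟩ := h
    refine ⟨⟨h3.trans h1, h4⟩, Finset.sdiff_subset_sdiff h1 subset_rfl, ?_⟩
    rw [Finset.card_sdiff_of_subset h3]
    omega
  · rintro ⟨X, Y⟩ h
    simp only [Finset.mem_sigma, Finset.mem_powersetCard] at h ⊢
    obtain ⟨⟨h1, h2⟩, h3, h4⟩ := h
    have h5 : Disjoint X Y := (Finset.disjoint_sdiff).mono_right h3
    refine ⟨⟨Finset.union_subset h1 (h3.trans Finset.sdiff_subset), ?_⟩,
      Finset.subset_union_left, h2⟩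
    rw [Finset.card_union_of_disjoint h5, h2, h4]
  · rintro ⟨B, X⟩ h
    simp only [Finset.mem_sigma, Finset.mem_powersetCard] at h
    simp only [Finset.union_sdiff_of_subset h.2.1]
  · rintro ⟨X, Y⟩ h
    simp only [Finset.mem_sigma, Finset.mem_powersetCard] at h
    have h5 : Disjoint X Y := (Finset.disjoint_sdiff).mono_right h.2.1
    simp only [Finset.union_sdiff_cancel_left h5]
  · rintro ⟨B, X⟩ h
    rfl

/-! ### Bialgebra axioms and cocommutativity -/

namespace SCHopf

variable {F : Type*} [Field F]

theorem eval₂_mul (s t : ℕ) (u v : InfUT F) (z w : SCHopf F ⊗[ℂ] SCHopf F) :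
    eval₂ s u t v (z * w) = ∑ p ∈ Finset.HasAntidiagonal.antidiagonal s,
      ∑ q ∈ Finset.HasAntidiagonal.antidiagonal t,
        eval₂ p.1 u q.1 v z * eval₂ p.2 (InfUT.shift p.1 u) q.2 (InfUT.shift q.1 v) w := by
  induction z using TensorProduct.induction_on with
  | zero => simp
  | add x y hx hy => simp only [add_mul, map_add, hx, hy, Finset.sum_add_distrib]
  | tmul x y =>
    induction w using TensorProduct.induction_on with
    | zero => simp
    | add x y hx hy => simp only [mul_add, map_add, hx, hy, Finset.sum_add_distrib]
    | tmul x' y' =>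
      rw [Algebra.TensorProduct.tmul_mul_tmul, eval₂_tmul, eval_mul, eval_mul,
        Finset.sum_mul_sum]
      simp only [eval₂_tmul, mul_mul_mul_comm]

/-- Both sides sum over ordered partitions of the interval into sets of sizes `s`, `t`, `r`, on
which `u`, `v`, `w` are placed. The left side first chooses the union of the first two sets, the
right side the first set. The inner sets are given by ranks and must be turned into actual subsets
before the sums can be compared. -/
theorem coassoc_eval (s t r : ℕ) (u v w : InfUT F) (x : SCHopf F) :
    ∑ A ∈ Finset.powersetCard s (Finset.range (s + t)),
      ∑ B ∈ Finset.powersetCard (s + t) (Finset.range (s + t + r)),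
        eval (s + t + r) (InfUT.merge (· ∈ B) (InfUT.merge (· ∈ A) u v) w) x =
    ∑ A ∈ Finset.powersetCard t (Finset.range (t + r)),
      ∑ B ∈ Finset.powersetCard s (Finset.range (s + (t + r))),
        eval (s + (t + r)) (InfUT.merge (· ∈ B) u (InfUT.merge (· ∈ A) v w)) x := by
  rw [Finset.sum_comm, Finset.sum_comm (s := Finset.powersetCard t _), add_assoc]
  have h1 : ∀ B ∈ Finset.powersetCard (s + t) (Finset.range (s + (t + r))),
      ∑ A ∈ Finset.powersetCard s (Finset.range (s + t)),
        eval (s + (t + r)) (InfUT.merge (· ∈ B) (InfUT.merge (· ∈ A) u v) w) x =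
      ∑ X ∈ Finset.powersetCard s B, eval (s + (t + r))
        (InfUT.merge (· ∈ X) u
          (InfUT.merge (· ∈ (B \ X).image (Nat.count (fun k => ¬ k ∈ X))) v w)) x := by
    intro B hB
    rw [Finset.mem_powersetCard] at hB
    rw [← hB.2, Finset.sum_powersetCard_range_card hB.1 (· ∈ B) (fun _ _ => Iff.rfl)]
    refine Finset.sum_congr rfl fun X hX => eval_congr (InfUT.merge_merge _ _ _ _ ?_ ?_ u v w) x
    · intro k _
      have hX := (Finset.mem_powersetCard.1 hX).1
      refine ⟨fun hk => ⟨hX hk, Finset.mem_image_of_mem _ hk⟩, fun ⟨hk, hk'⟩ => ?_⟩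
      obtain ⟨l, hl, hlk⟩ := Finset.mem_image.1 hk'
      exact Nat.count_injective (p := (· ∈ B)) (hX hl) hk hlk ▸ hl
    · intro k _ hk
      refine ⟨fun hk' => ?_, fun hk' => Finset.mem_image_of_mem _ (Finset.mem_sdiff.2 ⟨hk', hk⟩)⟩
      obtain ⟨l, hl, hlk⟩ := Finset.mem_image.1 hk'
      rw [Finset.mem_sdiff] at hl
      exact Nat.count_injective (p := fun k => ¬ k ∈ X) hl.2 hk hlk ▸ hl.1
  rw [Finset.sum_congr rfl h1, Finset.sum_powersetCard_powersetCard s t _ fun X Y =>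
    eval (s + (t + r)) (InfUT.merge (· ∈ X) u
      (InfUT.merge (· ∈ Y.image (Nat.count (fun k => ¬ k ∈ X))) v w)) x]
  refine Finset.sum_congr rfl fun X hX => ?_
  rw [Finset.mem_powersetCard] at hX
  have hcard : (Finset.range (s + (t + r)) \ X).card = t + r := by
    rw [Finset.card_sdiff_of_subset hX.1, Finset.card_range, hX.2]
    omega
  -- On the right the inner set consists of ranks in the complement of `X`, so the same conversion
  -- applies with that complement as `B`.
  have key := Finset.sum_powersetCard_range_card (B := Finset.range (s + (t + r)) \ X)
    Finset.sdiff_subset (fun k => ¬ k ∈ X) (fun k hk => by simp [hk]) t fun A =>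
      eval (s + (t + r)) (InfUT.merge (· ∈ X) u (InfUT.merge (· ∈ A) v w)) x
  rw [hcard] at key
  exact key.symm

variable [Finite F]

theorem eval₃_assoc_rTensor_comul (s t r : ℕ) (u v w : InfUT F) (z : SCHopf F ⊗[ℂ] SCHopf F) :
    eval₃ s u t v r w (TensorProduct.assoc ℂ _ _ _
      ((Coalgebra.comul (R := ℂ)).rTensor (SCHopf F) z)) =
      ∑ A ∈ Finset.powersetCard s (Finset.range (s + t)),
        eval₂ (s + t) (InfUT.merge (· ∈ A) u v) r w z := by
  induction z using TensorProduct.induction_on with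
  | zero => simp
  | add x y hx hy => simp only [map_add, hx, hy, Finset.sum_add_distrib]
  | tmul x y =>
    simp only [LinearMap.rTensor_tmul, eval₂_tmul, ← Finset.sum_mul, ← eval₂_comul]
    induction Coalgebra.comul (R := ℂ) x using TensorProduct.induction_on with
    | zero => simp
    | add x y hx hy => simp only [TensorProduct.add_tmul, map_add, hx, hy, add_mul]
    | tmul x x' => simp [mul_assoc]

theorem eval₃_lTensor_comul (s t r : ℕ) (u v w : InfUT F) (z : SCHopf F ⊗[ℂ] SCHopf F) :
    eval₃ s u t v r w ((Coalgebra.comul (R := ℂ)).lTensor (SCHopf F) z) =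
      ∑ A ∈ Finset.powersetCard t (Finset.range (t + r)),
        eval₂ s u (t + r) (InfUT.merge (· ∈ A) v w) z := by
  induction z using TensorProduct.induction_on with
  | zero => simp
  | add x y hx hy => simp only [map_add, hx, hy, Finset.sum_add_distrib]
  | tmul x y =>
    simp only [LinearMap.lTensor_tmul, eval₂_tmul, eval₃_tmul, ← Finset.mul_sum, eval₂_comul]

instance : Coalgebra ℂ (SCHopf F) where
  coassoc := LinearMap.ext fun x => ext_eval₃ fun s u t v r w => by
    simp only [LinearMap.comp_apply, LinearEquiv.coe_coe]
    rw [eval₃_assoc_rTensor_comul, eval₃_lTensor_comul]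
    simp only [eval₂_comul]
    exact coassoc_eval s t r u v w x
  rTensor_counit_comp_comul := LinearMap.ext fun x => by
    refine (TensorProduct.lid ℂ (SCHopf F)).injective <| ext_eval fun r w => ?_
    -- The counit is evaluation in size zero, so the only subset left in the coproduct formula is
    -- the empty one, and merging along it returns `w`.
    have h : ∀ z, eval r w (TensorProduct.lid ℂ (SCHopf F)
        ((Coalgebra.counit (R := ℂ)).rTensor (SCHopf F) z)) = eval₂ 0 1 r w z := fun z => by
      induction z using TensorProduct.induction_on with
      | zero => simp
      | add x y hx hy => simp only [map_add, hx, hy]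
      | tmul x y => simp [counit_eq_eval 1]
    rw [LinearMap.comp_apply, h, eval₂_comul, zero_add, Finset.powersetCard_zero,
      Finset.sum_singleton, eval_congr (InfUT.merge_false _ (by simp) 1 w)]
    simp
  lTensor_counit_comp_comul := LinearMap.ext fun x => by
    refine (TensorProduct.rid ℂ (SCHopf F)).injective <| ext_eval fun r w => ?_
    have h : ∀ z, eval r w (TensorProduct.rid ℂ (SCHopf F)
        ((Coalgebra.counit (R := ℂ)).lTensor (SCHopf F) z)) = eval₂ r w 0 1 z := fun z => by
      induction z using TensorProduct.induction_on with
      | zero => simp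
      | add x y hx hy => simp only [map_add, hx, hy]
      | tmul x y => simp [counit_eq_eval 1, mul_comm]
    -- On this side the only subset of the required size is the whole interval.
    have h2 := Finset.powersetCard_self (Finset.range r)
    rw [Finset.card_range] at h2
    rw [LinearMap.comp_apply, h, eval₂_comul, add_zero, h2, Finset.sum_singleton,
      eval_congr (InfUT.merge_true _ (by simp) w 1)]
    simp

/-- On the left one chooses an `s`-element subset of the interval of length `s + t` and a cut `a +
b` of the interval; on the right, cuts of `s` and `t` and a subset of each resulting piece. Cutting
the subset at `a` gives the bijection: `s₁` and `t₁` count the members and non-members before the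
cut. -/
theorem comul_mul (x y : SCHopf F) :
    Coalgebra.comul (R := ℂ) (x * y) = Coalgebra.comul (R := ℂ) x * Coalgebra.comul (R := ℂ) y := by
  refine ext_eval₂ fun s u t v => ?_
  rw [eval₂_comul, eval₂_mul]
  simp only [eval_mul, eval₂_comul, Finset.sum_mul_sum]
  simp only [← Finset.sum_product']
  rw [Finset.sum_sigma']
  -- `m1` and `m2` recover the two pieces from `A ∪ (a + B)`; `c1` and `c2` recover their sizes.
  have m1 : ∀ (a : ℕ) (A B : Finset ℕ), ∀ k < a,
      (k ∈ A ∪ B.map (addLeftEmbedding a) ↔ k ∈ A) := fun a A B k hk => by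
    simp only [Finset.mem_union, Finset.mem_map, addLeftEmbedding_apply, or_iff_left_iff_imp]
    rintro ⟨l, _, rfl⟩
    omega
  have m2 : ∀ (a : ℕ) (A B : Finset ℕ), A ⊆ Finset.range a → ∀ k,
      (a + k ∈ A ∪ B.map (addLeftEmbedding a) ↔ k ∈ B) := fun a A B hA k => by
    have : a + k ∉ A := fun h => by simpa using hA h
    simp [this]
  have c1 : ∀ (a : ℕ) (A B : Finset ℕ), A ⊆ Finset.range a →
      Nat.count (· ∈ A ∪ B.map (addLeftEmbedding a)) a = A.card := fun a A B hA =>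
    Nat.count_eq_card hA fun k hk => m1 a A B k hk
  have c2 : ∀ (a b : ℕ) (A B : Finset ℕ), A ⊆ Finset.range a → B ⊆ Finset.range b →
      Nat.count (fun k => a + k ∈ A ∪ B.map (addLeftEmbedding a)) b = B.card :=
    fun a b A B hA hB => Nat.count_eq_card hB fun k _ => m2 a A B hA k
  symm
  refine Finset.sum_bij'
    (fun c _ => (c.2.1 ∪ c.2.2.map (addLeftEmbedding (c.1.1.1 + c.1.2.1)),
      (c.1.1.1 + c.1.2.1, c.1.1.2 + c.1.2.2)))
    (fun c _ => ⟨((Nat.count (· ∈ c.1) c.2.1, Nat.count (fun k => c.2.1 + k ∈ c.1) c.2.2),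
      (Nat.count (fun k => ¬ k ∈ c.1) c.2.1, Nat.count (fun k => ¬ c.2.1 + k ∈ c.1) c.2.2)),
      ((Finset.range c.2.1).filter (· ∈ c.1),
        (Finset.range c.2.2).filter (fun k => c.2.1 + k ∈ c.1))⟩) ?_ ?_ ?_ ?_ ?_
  · rintro ⟨⟨⟨s₁, s₂⟩, t₁, t₂⟩, A, B⟩ h
    simp only [Finset.mem_sigma, Finset.mem_product, Finset.HasAntidiagonal.mem_antidiagonal,
      Finset.mem_powersetCard] at h ⊢
    obtain ⟨⟨rfl, rfl⟩, ⟨hA, rfl⟩, hB, rfl⟩ := h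
    refine ⟨⟨?_, ?_⟩, by omega⟩
    · refine Finset.union_subset (hA.trans (Finset.range_subset_range.2 (by omega))) fun k hk => ?_
      obtain ⟨l, hl, rfl⟩ := Finset.mem_map.1 hk
      have := Finset.mem_range.1 (hB hl)
      rw [addLeftEmbedding_apply, Finset.mem_range]
      omega
    · rw [Finset.card_union_of_disjoint, Finset.card_map]
      refine Finset.disjoint_left.2 fun k hk hk' => ?_
      obtain ⟨l, hl, rfl⟩ := Finset.mem_map.1 hk'
      simpa using hA hk
  · rintro ⟨A, a, b⟩ h
    simp only [Finset.mem_sigma, Finset.mem_product, Finset.HasAntidiagonal.mem_antidiagonal,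
      Finset.mem_powersetCard] at h ⊢
    obtain ⟨⟨hA, hs⟩, hab⟩ := h
    have h1 := Nat.count_add_count_not (· ∈ A) a
    have h2 := Nat.count_add_count_not (fun k => a + k ∈ A) b
    have h3 := Nat.count_add (· ∈ A) a b
    rw [hab, Nat.count_eq_card hA fun _ _ => Iff.rfl, hs] at h3
    refine ⟨⟨h3.symm, by omega⟩, ⟨?_, ?_⟩, ?_, ?_⟩
    · rw [h1]; exact Finset.filter_subset _ _
    · rw [Nat.count_eq_card_filter_range]
    · rw [h2]; exact Finset.filter_subset _ _
    · rw [Nat.count_eq_card_filter_range]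
  · rintro ⟨⟨⟨s₁, s₂⟩, t₁, t₂⟩, A, B⟩ h
    simp only [Finset.mem_sigma, Finset.mem_product, Finset.HasAntidiagonal.mem_antidiagonal,
      Finset.mem_powersetCard] at h
    obtain ⟨_, ⟨hA, hA'⟩, hB, hB'⟩ := h
    have e1 := (c1 _ A B hA).trans hA'
    have e2 := (c2 _ _ A B hA hB).trans hB'
    have e3 := Nat.count_add_count_not (· ∈ A ∪ B.map (addLeftEmbedding (s₁ + t₁))) (s₁ + t₁)
    have e4 := Nat.count_add_count_not
      (fun k => s₁ + t₁ + k ∈ A ∪ B.map (addLeftEmbedding (s₁ + t₁))) (s₂ + t₂)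
    simp only [Sigma.mk.injEq, Prod.mk.injEq, heq_eq_eq]
    refine ⟨⟨⟨e1, e2⟩, by omega, by omega⟩, ?_, ?_⟩
    · ext k
      rw [Finset.mem_filter, Finset.mem_range]
      exact ⟨fun ⟨h1, h2⟩ => (m1 _ A B k h1).1 h2, fun hk =>
        ⟨Finset.mem_range.1 (hA hk), Finset.mem_union_left _ hk⟩⟩
    · ext k
      rw [Finset.mem_filter, Finset.mem_range, m2 _ A B hA]
      exact ⟨fun h => h.2, fun hk => ⟨Finset.mem_range.1 (hB hk), hk⟩⟩
  · rintro ⟨A, a, b⟩ h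
    simp only [Finset.mem_product, Finset.HasAntidiagonal.mem_antidiagonal,
      Finset.mem_powersetCard] at h
    obtain ⟨⟨hA, hs⟩, hab⟩ := h
    simp only [Prod.mk.injEq]
    rw [Nat.count_add_count_not, Nat.count_add_count_not (fun k => a + k ∈ A)]
    refine ⟨?_, rfl, rfl⟩
    ext k
    rcases lt_or_ge k a with hk | hk
    · rw [m1 _ _ _ _ hk, Finset.mem_filter, Finset.mem_range]
      exact and_iff_right hk
    · obtain ⟨k, rfl⟩ := Nat.exists_eq_add_of_le hk
      rw [m2 _ _ _ (Finset.filter_subset _ _), Finset.mem_filter, Finset.mem_range]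
      refine and_iff_right_of_imp fun hk' => ?_
      have := Finset.mem_range.1 (hA hk')
      omega
  · rintro ⟨⟨⟨s₁, s₂⟩, t₁, t₂⟩, A, B⟩ h
    simp only [Finset.mem_sigma, Finset.mem_product, Finset.HasAntidiagonal.mem_antidiagonal,
      Finset.mem_powersetCard] at h ⊢
    obtain ⟨_, ⟨hA, hA'⟩, hB, hB'⟩ := h
    have e1 := (c1 _ A B hA).trans hA'
    have e3 := Nat.count_add_count_not (· ∈ A ∪ B.map (addLeftEmbedding (s₁ + t₁))) (s₁ + t₁)
    rw [e1] at e3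
    -- The lower block of the merge is the merge along `B` of `u` shifted by `s₁` and `v` shifted by
    -- `t₁`; the upper block sees only `A`.
    rw [InfUT.shift_merge _ _ (· ∈ B) (fun k => (m2 _ A B hA k).symm), e1,
      Nat.add_left_cancel e3]
    congr 1
    exact eval_congr (InfUT.merge_congr (fun k hk => (m1 _ A B k hk).symm) u v) x

theorem comul_one : Coalgebra.comul (R := ℂ) (1 : SCHopf F) = 1 := by
  refine ext_eval₂ fun s u t v => ?_
  rw [eval₂_comul, Algebra.TensorProduct.one_def, eval₂_tmul]
  simp only [eval_one]
  by_cases hs : s = 0 <;> by_cases ht : t = 0 <;> simp [hs, ht]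

instance : Bialgebra ℂ (SCHopf F) :=
  Bialgebra.mk' ℂ (SCHopf F)
    (by rw [counit_eq_eval 1, eval_one, if_pos rfl])
    (fun {x y} => by
      simp [counit_eq_eval 1, eval_mul])
    comul_one (fun {x y} => comul_mul x y)

instance : Coalgebra.IsCocomm ℂ (SCHopf F) where
  comm_comp_comul := LinearMap.ext fun x => ext_eval₂ fun s u t v => by
    have h : ∀ z, eval₂ s u t v (TensorProduct.comm ℂ _ _ z) = eval₂ t v s u z := fun z => by
      induction z using TensorProduct.induction_on with
      | zero => simp
      | add x y hx hy => simp only [map_add, hx, hy]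
      | tmul x y => simp [mul_comm]
    refine (h _).trans ?_
    rw [eval₂_comul, eval₂_comul, add_comm t s]
    have h1 : ∀ A ⊆ Finset.range (s + t), Finset.range (s + t) \ (Finset.range (s + t) \ A) = A :=
      fun A hA => Finset.sdiff_sdiff_eq_self hA
    have h2 : ∀ k l, k + l = s + t → ∀ A ∈ Finset.powersetCard k (Finset.range (s + t)),
        Finset.range (s + t) \ A ∈ Finset.powersetCard l (Finset.range (s + t)) := by
      intro k l hkl A hA
      rw [Finset.mem_powersetCard] at hA ⊢
      refine ⟨Finset.sdiff_subset, ?_⟩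
      rw [Finset.card_sdiff_of_subset hA.1, Finset.card_range]
      omega
    -- Exchanging `u` and `v` amounts to replacing a subset by its complement.
    refine Finset.sum_bij' (fun A _ => Finset.range (s + t) \ A)
      (fun A _ => Finset.range (s + t) \ A) (h2 t s (add_comm t s)) (h2 s t rfl)
      (fun A hA => h1 A (Finset.mem_powersetCard.1 hA).1)
      (fun A hA => h1 A (Finset.mem_powersetCard.1 hA).1) fun A hA => ?_
    exact eval_congr (InfUT.merge_not (by simp +contextual) v u) x

end SCHopf

/-! ### Antipodes of connected graded bialgebras -/

section Antipode

open WithConv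

variable {k H : Type*} [Field k] [Ring H] [Bialgebra k H] {𝒜 : ℕ → Submodule k H}

/-- Reduces claims about a coproduct to pure tensors of homogeneous elements. With `W = ⊥` it proves
vanishing, with `W` a homogeneous component it proves preservation of degree. -/
theorem map_comul_mem_of_graded {M : Type*} [AddCommGroup M] [Module k M] {n : ℕ} {x : H}
    (hx : Coalgebra.comul (R := k) x ∈ ⨆ p ∈ Finset.HasAntidiagonal.antidiagonal n,
      LinearMap.range (TensorProduct.map (𝒜 p.1).subtype (𝒜 p.2).subtype))
    (φ : H ⊗[k] H →ₗ[k] M) (W : Submodule k M)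
    (h : ∀ i j, i + j = n → ∀ a ∈ 𝒜 i, ∀ b ∈ 𝒜 j, φ (a ⊗ₜ b) ∈ W) :
    φ (Coalgebra.comul (R := k) x) ∈ W := by
  suffices hle : (⨆ p ∈ Finset.HasAntidiagonal.antidiagonal n,
      LinearMap.range (TensorProduct.map (𝒜 p.1).subtype (𝒜 p.2).subtype)) ≤ W.comap φ from hle hx
  refine iSup₂_le fun p hp => ?_
  rintro _ ⟨z, rfl⟩
  rw [Finset.HasAntidiagonal.mem_antidiagonal] at hp
  induction z using TensorProduct.induction_on with
  | zero => simp
  | add x y hx hy => rw [map_add]; exact Submodule.add_mem _ hx hy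
  | tmul a b => exact h _ _ hp a a.2 b b.2

/-- In the convolution algebra the identity is `1 - N`, where `N` vanishes in degree zero by
`hconn`. In an iterated coproduct of an element of degree below `m`, some one of `m` legs has degree
zero, so `N ^ m` kills it. Therefore `∑ N ^ i` is a finite sum in each degree and inverts `1 - N`;
it preserves degrees because `N` and `1` do. -/
theorem exists_graded_antipode (hint : DirectSum.IsInternal 𝒜)
    (hmul : ∀ i j : ℕ, ∀ x ∈ 𝒜 i, ∀ y ∈ 𝒜 j, x * y ∈ 𝒜 (i + j))
    (hcomul : ∀ n : ℕ, ∀ x ∈ 𝒜 n, Coalgebra.comul (R := k) x ∈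
      ⨆ p ∈ Finset.HasAntidiagonal.antidiagonal n,
        LinearMap.range (TensorProduct.map (𝒜 p.1).subtype (𝒜 p.2).subtype))
    (hcounit : ∀ n : ℕ, 1 ≤ n → ∀ x ∈ 𝒜 n, Coalgebra.counit (R := k) x = 0)
    (hconn : ∀ x ∈ 𝒜 0, algebraMap k H (Coalgebra.counit x) = x) :
    ∃ S : H →ₗ[k] H, toConv S * toConv LinearMap.id = 1 ∧ toConv LinearMap.id * toConv S = 1 ∧
      ∀ n, ∀ x ∈ 𝒜 n, S x ∈ 𝒜 n := by
  let N : WithConv (H →ₗ[k] H) := 1 - toConv LinearMap.id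
  have hid : toConv LinearMap.id = 1 - N := (sub_sub_cancel _ _).symm
  have hN : ∀ x, N.ofConv x = algebraMap k H (Coalgebra.counit x) - x := fun x => rfl
  have hmulconv : ∀ (f g : WithConv (H →ₗ[k] H)) (x : H), (f * g).ofConv x =
      LinearMap.mul' k H (TensorProduct.map f.ofConv g.ofConv (Coalgebra.comul x)) :=
    fun f g x => rfl
  have hkill : ∀ m n, n < m → ∀ x ∈ 𝒜 n, (N ^ m).ofConv x = 0 := by
    intro m
    induction m with
    | zero => intro n hn; omega
    | succ m ih =>
      intro n hn x hx
      rw [pow_succ', hmulconv, ← LinearMap.comp_apply, ← Submodule.mem_bot k]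
      refine map_comul_mem_of_graded (hcomul n x hx) _ _ fun i j hij a ha b hb => ?_
      rw [Submodule.mem_bot, LinearMap.comp_apply, TensorProduct.map_tmul, LinearMap.mul'_apply]
      rcases Nat.eq_zero_or_pos i with rfl | hi
      · rw [hN, hconn a ha, sub_self, zero_mul]
      · rw [ih j (by omega) b hb, mul_zero]
  have hdeg : ∀ m n, ∀ x ∈ 𝒜 n, (N ^ (m + 1)).ofConv x ∈ 𝒜 n := by
    have h1 : ∀ n, ∀ x ∈ 𝒜 n, N.ofConv x ∈ 𝒜 n := by
      intro n x hx
      rw [hN]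
      rcases Nat.eq_zero_or_pos n with rfl | hn
      · rw [hconn x hx, sub_self]; exact zero_mem _
      · rw [hcounit n hn x hx, map_zero, zero_sub]; exact neg_mem hx
    intro m
    induction m with
    | zero => simpa using h1
    | succ m ih =>
      intro n x hx
      rw [pow_succ', hmulconv, ← LinearMap.comp_apply]
      refine map_comul_mem_of_graded (hcomul n x hx) _ _ fun i j hij a ha b hb => ?_
      rw [LinearMap.comp_apply, TensorProduct.map_tmul, LinearMap.mul'_apply, ← hij]
      exact hmul _ _ _ (h1 i a ha) _ (ih j b hb)
  have hdeg0 : ∀ n, ∀ x ∈ 𝒜 n, (1 : WithConv (H →ₗ[k] H)).ofConv x ∈ 𝒜 n := by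
    intro n x hx
    change algebraMap k H (Coalgebra.counit x) ∈ 𝒜 n
    rcases Nat.eq_zero_or_pos n with rfl | hn
    · rwa [hconn x hx]
    · rw [hcounit n hn x hx, map_zero]; exact zero_mem _
  let G (n : ℕ) : WithConv (H →ₗ[k] H) := ∑ i ∈ Finset.range n, N ^ i
  -- In degree `n` the powers from `n + 1` on vanish, so `n + 1` terms give the whole series.
  let S : H →ₗ[k] H := DirectSum.toModule k ℕ H (fun n => (G (n + 1)).ofConv ∘ₗ (𝒜 n).subtype) ∘ₗ
    (LinearEquiv.ofBijective (DirectSum.coeLinearMap 𝒜) hint).symm.toLinearMap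
  have hS : ∀ n, ∀ x ∈ 𝒜 n, S x = (G (n + 1)).ofConv x := by
    intro n x hx
    have : (LinearEquiv.ofBijective (DirectSum.coeLinearMap 𝒜) hint).symm x =
        DirectSum.lof k ℕ (fun n => 𝒜 n) n ⟨x, hx⟩ := by
      rw [LinearEquiv.symm_apply_eq]
      exact (DirectSum.coeLinearMap_lof 𝒜 n ⟨x, hx⟩).symm
    simp only [S, LinearMap.comp_apply, LinearEquiv.coe_coe, this, DirectSum.toModule_lof]
    rfl
  have hG : ∀ n m, n < m → ∀ x ∈ 𝒜 n, (G m).ofConv x = S x := by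
    intro n m hnm x hx
    rw [hS n x hx]
    induction m, hnm using Nat.le_induction with
    | base => rfl
    | succ m hm ih =>
      rw [← ih]
      simp only [G, Finset.sum_range_succ, ofConv_add, LinearMap.add_apply]
      rw [hkill m n hm x hx, add_zero]
  have hext : ∀ f g : WithConv (H →ₗ[k] H), (∀ n, ∀ x ∈ 𝒜 n, f.ofConv x = g.ofConv x) →
      f = g := by
    intro f g h
    refine WithConv.ext (LinearMap.ext fun x => ?_)
    have hx : x ∈ iSup 𝒜 := hint.submodule_iSup_eq_top ▸ Submodule.mem_top
    induction hx using Submodule.iSup_induction' with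
    | mem n x hx => exact h n x hx
    | zero => simp
    | add x y _ _ hx hy => rw [map_add, map_add, hx, hy]
  refine ⟨S, hext _ _ fun n x hx => ?_, hext _ _ fun n x hx => ?_, fun n x hx => ?_⟩
  · have h1 : (toConv S * toConv LinearMap.id).ofConv x =
        (G (n + 1) * toConv LinearMap.id).ofConv x := by
      rw [← sub_eq_zero, hmulconv, hmulconv, ← map_sub, ← LinearMap.sub_apply,
        ← LinearMap.comp_apply, ← Submodule.mem_bot k]
      refine map_comul_mem_of_graded (hcomul n x hx) _ _ fun i j hij a ha b hb => ?_
      rw [Submodule.mem_bot, LinearMap.comp_apply, LinearMap.sub_apply, TensorProduct.map_tmul,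
        TensorProduct.map_tmul, hG i (n + 1) (by omega) a ha, ofConv_toConv, sub_self, map_zero]
    rw [h1, hid, geom_sum_mul_neg, ofConv_sub, LinearMap.sub_apply,
      hkill _ n (Nat.lt_succ_self n) x hx, sub_zero]
  · have h1 : (toConv LinearMap.id * toConv S).ofConv x =
        (toConv LinearMap.id * G (n + 1)).ofConv x := by
      rw [← sub_eq_zero, hmulconv, hmulconv, ← map_sub, ← LinearMap.sub_apply,
        ← LinearMap.comp_apply, ← Submodule.mem_bot k]
      refine map_comul_mem_of_graded (hcomul n x hx) _ _ fun i j hij a ha b hb => ?_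
      rw [Submodule.mem_bot, LinearMap.comp_apply, LinearMap.sub_apply, TensorProduct.map_tmul,
        TensorProduct.map_tmul, hG j (n + 1) (by omega) b hb, ofConv_toConv, sub_self, map_zero]
    rw [h1, hid, mul_neg_geom_sum, ofConv_sub, LinearMap.sub_apply,
      hkill _ n (Nat.lt_succ_self n) x hx, sub_zero]
  · rw [hS n x hx]
    simp only [G, ofConv_sum, LinearMap.sum_apply]
    refine Submodule.sum_mem _ fun i _ => ?_
    rcases i with _ | i
    · exact hdeg0 n x hx
    · exact hdeg i n x hx

end Antipode

/-! ### The grading by matrix size -/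

namespace SCHopf

variable {F : Type*} [Field F]

variable (F) in
/-- The homogeneous component of degree `n`. -/
abbrev degree (n : ℕ) : Submodule ℂ (SCHopf F) := (SC.degree F n).map (equiv F).toLinearMap

variable (F) in
/-- The inclusion of `SCₙ` into the homogeneous component of degree `n`. -/
def ofDegree (n : ℕ) : SuperclassFun n F →ₗ[ℂ] degree F n :=
  LinearMap.codRestrict _ ((equiv F).toLinearMap ∘ₗ SC.of F n) fun χ => ⟨_, ⟨χ, rfl⟩, rfl⟩

theorem coe_ofDegree (n : ℕ) (χ : SuperclassFun n F) :
    (ofDegree F n χ : SCHopf F) = equiv F (SC.of F n χ) := rfl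

theorem ofDegree_surjective (n : ℕ) : Function.Surjective (ofDegree F n) := by
  rintro ⟨_, _, ⟨χ, rfl⟩, rfl⟩
  exact ⟨χ, rfl⟩

theorem isInternal_degree : DirectSum.IsInternal (degree F) := by
  let d : SCHopf F →ₗ[ℂ] DirectSum ℕ fun n => degree F n :=
    DirectSum.toModule ℂ ℕ _ (fun n => DirectSum.lof ℂ ℕ (fun n => degree F n) n ∘ₗ ofDegree F n)
      ∘ₗ (equiv F).symm.toLinearMap
  have hd : ∀ n χ, d (equiv F (SC.of F n χ)) =
      DirectSum.lof ℂ ℕ (fun n => degree F n) n (ofDegree F n χ) := fun n χ => by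
    simp [d, SC.of]
  have h1 : ∀ x, DirectSum.coeLinearMap (degree F) (d x) = x := by
    intro x
    obtain ⟨x, rfl⟩ := (equiv F).surjective x
    induction x using SC.induction_on with
    | of n χ => rw [hd, DirectSum.coeLinearMap_lof, coe_ofDegree]
    | add x y hx hy => simp only [map_add, hx, hy]
  have h2 : ∀ y, d (DirectSum.coeLinearMap (degree F) y) = y := by
    intro y
    induction y using DirectSum.induction_on with
    | zero => simp
    | of n y =>
      obtain ⟨χ, rfl⟩ := ofDegree_surjective n y
      have := DirectSum.coeLinearMap_lof (degree F) n (ofDegree F n χ)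
      rw [DirectSum.lof_eq_of] at this
      rw [this, coe_ofDegree, hd, DirectSum.lof_eq_of]
    | add x y hx hy => simp only [map_add, hx, hy]
  exact ⟨Function.LeftInverse.injective h2, Function.LeftInverse.surjective h1⟩

theorem mul_mem_degree (i j : ℕ) : ∀ x ∈ degree F i, ∀ y ∈ degree F j,
    x * y ∈ degree F (i + j) := by
  rintro _ ⟨_, ⟨χ, rfl⟩, rfl⟩ _ ⟨_, ⟨ψ, rfl⟩, rfl⟩
  exact ⟨_, ⟨_, (SC.mul_of_of i j χ ψ).symm⟩, rfl⟩

variable [Finite F]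

theorem comul_mem_degree (n : ℕ) : ∀ x ∈ degree F n, Coalgebra.comul (R := ℂ) x ∈
    ⨆ p ∈ Finset.HasAntidiagonal.antidiagonal n,
      LinearMap.range (TensorProduct.map (degree F p.1).subtype (degree F p.2).subtype) := by
  rintro _ ⟨_, ⟨χ, rfl⟩, rfl⟩
  have h : Coalgebra.comul (R := ℂ) (equiv F (SC.of F n χ)) =
      TensorProduct.map (equiv F).toLinearMap (equiv F).toLinearMap
        (SC.comul F (SC.of F n χ)) := rfl
  refine (congrArg (· ∈ _) h).mpr ?_
  rw [SC.comul_of, map_sum]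
  refine Submodule.sum_mem _ fun A _ => ?_
  have hA : (A.card, Aᶜ.card) ∈ Finset.HasAntidiagonal.antidiagonal n := by
    rw [Finset.HasAntidiagonal.mem_antidiagonal]
    simp
  refine Submodule.mem_iSup_of_mem (A.card, Aᶜ.card) (Submodule.mem_iSup_of_mem hA ?_)
  -- Only the degrees of the two legs matter, so the particular tensor is forgotten.
  generalize (SuperclassFun.tensorEquiv A.card Aᶜ.card F).symm _ = z
  refine ⟨TensorProduct.map (ofDegree F A.card) (ofDegree F Aᶜ.card) z, ?_⟩
  induction z using TensorProduct.induction_on with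
  | zero => simp
  | add x y hx hy => simp only [map_add, hx, hy]
  | tmul x y => rfl

theorem counit_eq_zero_of_mem_degree (n : ℕ) (hn : 1 ≤ n) : ∀ x ∈ degree F n,
    Coalgebra.counit (R := ℂ) x = 0 := by
  rintro _ ⟨_, ⟨χ, rfl⟩, rfl⟩
  rw [counit_eq_eval 1, LinearEquiv.coe_coe, eval_equiv, SC.eval_of, if_neg (by omega)]

/-- Connectedness: `UT 0 F` has one element, so a function on it is its value times the unit. -/
theorem algebraMap_counit_of_mem_degree_zero : ∀ x ∈ degree F 0,
    algebraMap ℂ (SCHopf F) (Coalgebra.counit x) = x := by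
  rintro _ ⟨_, ⟨χ, rfl⟩, rfl⟩
  refine ext_eval fun n u => ?_
  rw [Algebra.algebraMap_eq_smul_one, map_smul, eval_one, counit_eq_eval u, LinearEquiv.coe_coe,
    eval_equiv, eval_equiv, SC.eval_of, SC.eval_of]
  split_ifs <;> simp_all

end SCHopf

end

/-! ### Assembly of the Hopf algebra -/

theorem mainTheorem3 (F : Type u) [Field F] [Finite F] :
    ∃ (H : Type u) (_ : Ring H) (_ : HopfAlgebra ℂ H) (e : SC F ≃ₗ[ℂ] H),
      (∀ x y : SC F, e (SC.mul F x y) = e x * e y) ∧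
      e (SC.one F) = 1 ∧
      (∀ x : SC F, Coalgebra.comul (R := ℂ) (e x) =
        TensorProduct.map e.toLinearMap e.toLinearMap (SC.comul F x)) ∧
      (∀ x : SC F, Coalgebra.counit (R := ℂ) (e x) = SC.counit F x) ∧
      Coalgebra.IsCocomm ℂ H ∧
      IsHopfGrading (k := ℂ) (fun n => (SC.degree F n).map e.toLinearMap) := by
  obtain ⟨S, h1, h2, h3⟩ := exists_graded_antipode (SCHopf.isInternal_degree (F := F))
    SCHopf.mul_mem_degree SCHopf.comul_mem_degree SCHopf.counit_eq_zero_of_mem_degree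
    SCHopf.algebraMap_counit_of_mem_degree_zero
  let _ := HopfAlgebra.ofConvInverse S h1 h2
  -- The structure on `SCHopf F` was transported along `SCHopf.equiv`, whose underlying map is the
  -- identity, so compatibility with the given operations is definitional.
  refine ⟨SCHopf F, inferInstance, HopfAlgebra.ofConvInverse S h1 h2, SCHopf.equiv F,
    fun _ _ => rfl, rfl, fun _ => rfl, fun _ => rfl, inferInstance, ?_⟩
  exact
    { isInternal := SCHopf.isInternal_degree
      one_mem := ⟨_, ⟨_, rfl⟩, rfl⟩
      mul_mem := SCHopf.mul_mem_degree
      comul_mem := SCHopf.comul_mem_degree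
      counit_eq_zero := SCHopf.counit_eq_zero_of_mem_degree
      antipode_mem := h3 }
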